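/- Let $0\le v_1<v_2$ and $\alpha_{12},\alpha_{21}>0$. For $N_1,N_2\in\mathbb N$ consider $N_1$ particles of type $1$ and $N_2$ particles of type $2$ on the line $\mathbb R$, with coordinates $x^{(1)}_1(t),\dots,x^{(1)}_{N_1}(t)$ and $x^{(2)}_1(t),\dots,x^{(2)}_{N_2}(t)$ at time $t\ge 0$. A particle of type $i$ moves with constant velocity $v_i$; in addition, independently of the others, each particle of type $1$ jumps with rate $\alpha_{12}/N_2$ to the position of each given particle of type $2$, and each particle of type $2$ jumps with rate $\alpha_{21}/N_1$ to the position of each given particle of type $1$. That is, the configuration $(x^{(1)}(t),x^{(2)}(t))$ is the right-continuous Markov process with left limits in $\mathbb R^{N_1+N_2}$ (the càdlàg solution of the martingale problem on bounded $C^1$ functions $f$ with bounded derivative) with generator $$Lf(x)=v_1\sum_{i}\frac{\partial f}{\partial x^{(1)}_i}(x)+v_2\sum_{j}\frac{\partial f}{\partial x^{(2)}_j}(x)+\sum_{i,j}\frac{\alpha_{12}}{N_2}\bigl[f(x_{i\to j})-f(x)\bigr]+\sum_{i,j}\frac{\alpha_{21}}{N_1}\bigl[f(x_{i\leftarrow j})-f(x)\bigr],$$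 where $x_{i\to j}$ (resp. $x_{i\leftarrow j}$) is $x$ with $x^{(1)}_i$ replaced by $x^{(2)}_j$ (resp. with $x^{(2)}_j$ replaced by $x^{(1)}_i$). The initial positions may be deterministic or random. Let $$m^{(N_i)}_i(t,\cdot)=\frac1{N_i}\sum_{k=1}^{N_i}\delta_{x^{(i)}_k(t)},\qquad i=1,2,$$ be the empirical measures. Consider a sequence of pairs $(N_1,N_2)$ with $N_1,N_2\to\infty$ and $N_i/(N_1+N_2)\to c_i$, where $c_1,c_2>0$ and $c_1+c_2=1$, and assume that for $i=1,2$ and every bounded $C^1$ function $\phi:\mathbb R\to\mathbb R$ the sequence $\langle m^{(N_i)}_i(0,\cdot),\phi\rangle$ converges (in probability, if the initial positions are random) to some number. Then there are deterministic families of probability measures $m_1(t,\cdot),m_2(t,\cdot)$ on $\mathbb R$, $t\ge 0$, such that for every fixed $t\ge0$ and $i=1,2$ the empirical measure $m^{(N_i)}_i(t,\cdot)$ converges weakly to $m_i(t,\cdot)$ in probability, that is, $\langle m^{(N_i)}_i(t,\cdot),\phi\rangle\to\langle m_i(t,\cdot),\phi\rangle$ in probability for every bounded continuous $\phi$. Moreover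 $(m_1,m_2)$ is a weak solution of $$\frac{\partial m_1}{\partial t}+v_1\frac{\partial m_1}{\partial x}=\alpha_{12}(m_2-m_1),\qquad \frac{\partial m_2}{\partial t}+v_2\frac{\partial m_2}{\partial x}=\alpha_{21}(m_1-m_2),$$ that is, for all Schwartz functions $\phi_1,\phi_2$ on $\mathbb R$ and all $t\ge0$ the integrand below is integrable on $[0,t]$ and $$\langle m_1(t),\phi_1\rangle+\langle m_2(t),\phi_2\rangle=\langle m_1(0),\phi_1\rangle+\langle m_2(0),\phi_2\rangle+\int_0^t\Bigl(\langle m_1(s),v_1\phi_1'-\alpha_{12}\phi_1+\alpha_{21}\phi_2\rangle+\langle m_2(s),v_2\phi_2'+\alpha_{12}\phi_1-\alpha_{21}\phi_2\rangle\Bigr)ds .$$ -/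

import Mathlib

open MeasureTheory ProbabilityTheory Filter Topology
open scoped NNReal ENNReal BoundedContinuousFunction SchwartzMap

noncomputable section

namespace TimeSync

/-- Configurations of `N₁` particles of type `1` and `N₂` particles of type `2` on the line. -/
abbrev Config (N₁ N₂ : ℕ) : Type := (Fin N₁ → ℝ) × (Fin N₂ → ℝ)

/-- The configuration after particle `i` of type `1` has jumped to particle `j` of type `2`. -/
def jump₁₂ {N₁ N₂ : ℕ} (x : Config N₁ N₂) (i : Fin N₁) (j : Fin N₂) : Config N₁ N₂ :=
  (Function.update x.1 i (x.2 j), x.2)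

/-- The configuration after particle `j` of type `2` has jumped to particle `i` of type `1`. -/
def jump₂₁ {N₁ N₂ : ℕ} (x : Config N₁ N₂) (j : Fin N₂) (i : Fin N₁) : Config N₁ N₂ :=
  (x.1, Function.update x.2 j (x.1 i))

/-- The generator of the particle system on `C¹` functions.  The first summand is the derivative
of `f` along the vector `(v₁, …, v₁; v₂, …, v₂)`, that is
`v₁ ∑ᵢ ∂f/∂xᵢ⁽¹⁾ + v₂ ∑ⱼ ∂f/∂xⱼ⁽²⁾`. -/
def generator (v₁ v₂ α₁₂ α₂₁ : ℝ) {N₁ N₂ : ℕ} (f : Config N₁ N₂ → ℝ) (x : Config N₁ N₂) : ℝ :=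
  fderiv ℝ f x ((fun _ => v₁), (fun _ => v₂))
    + ∑ i : Fin N₁, ∑ j : Fin N₂, α₁₂ / (N₂ : ℝ) * (f (jump₁₂ x i j) - f x)
    + ∑ j : Fin N₂, ∑ i : Fin N₁, α₂₁ / (N₁ : ℝ) * (f (jump₂₁ x j i) - f x)

/-- Bounded `C¹` functions with bounded derivative, the domain on which the generator is used. -/
def IsTestFunction {N₁ N₂ : ℕ} (f : Config N₁ N₂ → ℝ) : Prop :=
  ContDiff ℝ 1 f ∧ (∃ C : ℝ, ∀ x, |f x| ≤ C) ∧ (∃ C : ℝ, ∀ x, ‖fderiv ℝ f x‖ ≤ C)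

/-- Right-continuous with left limits. -/
def IsCadlag {E : Type*} [TopologicalSpace E] (x : ℝ≥0 → E) : Prop :=
  ∀ t : ℝ≥0, ContinuousWithinAt x (Set.Ici t) t ∧ ∃ l : E, Tendsto x (𝓝[<] t) (𝓝 l)

/-- `X` is the particle system: the càdlàg Markov process with the above generator, described by
its martingale problem.  The law of `X 0` is arbitrary. -/
structure IsParticleSystem (v₁ v₂ α₁₂ α₂₁ : ℝ) {N₁ N₂ : ℕ} {Ω : Type*} {mΩ : MeasurableSpace Ω}
    (P : Measure Ω) (𝓕 : Filtration ℝ≥0 mΩ) (X : ℝ≥0 → Ω → Config N₁ N₂) : Prop where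
  adapted : ∀ t : ℝ≥0, Measurable[𝓕 t] (X t)
  cadlag : ∀ ω : Ω, IsCadlag (fun t => X t ω)
  martingale : ∀ f : Config N₁ N₂ → ℝ, IsTestFunction f →
    Martingale (fun (t : ℝ≥0) (ω : Ω) => f (X t ω) - f (X 0 ω)
      - ∫ s in (0 : ℝ)..(t : ℝ), generator v₁ v₂ α₁₂ α₂₁ f (X s.toNNReal ω)) 𝓕 P

/-- The empirical measure `N⁻¹ ∑ₖ δ_{xₖ}`. -/
def empiricalMeasure {N : ℕ} (x : Fin N → ℝ) : Measure ℝ :=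
  (N : ℝ≥0∞)⁻¹ • ∑ k : Fin N, Measure.dirac (x k)

/-- A sequence of real random variables, the `n`-th one on the probability space
`(Ω n, P n)`, converges in probability (equivalently, in law) to the number `a`. -/
def TendstoInProbability {Ω : ℕ → Type*} {mΩ : ∀ n, MeasurableSpace (Ω n)}
    (P : ∀ n, Measure (Ω n)) (Y : ∀ n, Ω n → ℝ) (a : ℝ) : Prop :=
  ∀ ε : ℝ, 0 < ε → Tendsto (fun n => P n {ω | ε ≤ |Y n ω - a|}) atTop (𝓝 0)

/-- A sequence of random measures on `ℝ` converges weakly, in probability, to the deterministic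
probability measure `m`. -/
def TendstoWeaklyInProbability {Ω : ℕ → Type*} {mΩ : ∀ n, MeasurableSpace (Ω n)}
    (P : ∀ n, Measure (Ω n)) (M : ∀ n, Ω n → Measure ℝ) (m : ProbabilityMeasure ℝ) : Prop :=
  ∀ φ : ℝ →ᵇ ℝ, TendstoInProbability P (fun n ω => ∫ x, φ x ∂(M n ω)) (∫ x, φ x ∂(m : Measure ℝ))

/-- The pairing of `(μ₁, μ₂)` with the test pair
`(v₁ φ₁' - α₁₂ φ₁ + α₂₁ φ₂, v₂ φ₂' + α₁₂ φ₁ - α₂₁ φ₂)`. -/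
def weakRHS (v₁ v₂ α₁₂ α₂₁ : ℝ) (φ₁ φ₂ : 𝓢(ℝ, ℝ)) (μ₁ μ₂ : Measure ℝ) : ℝ :=
  (∫ x, (v₁ * deriv φ₁ x - α₁₂ * φ₁ x + α₂₁ * φ₂ x) ∂μ₁)
    + ∫ x, (v₂ * deriv φ₂ x + α₁₂ * φ₁ x - α₂₁ * φ₂ x) ∂μ₂

/-- `(m₁, m₂)` is a weak (measure-valued) solution on `[0, ∞)` of the system
`∂ₜ m₁ + v₁ ∂ₓ m₁ = α₁₂ (m₂ - m₁)`, `∂ₜ m₂ + v₂ ∂ₓ m₂ = α₂₁ (m₁ - m₂)`. -/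
def IsWeakSolution (v₁ v₂ α₁₂ α₂₁ : ℝ) (m₁ m₂ : ℝ≥0 → ProbabilityMeasure ℝ) : Prop :=
  ∀ φ₁ φ₂ : 𝓢(ℝ, ℝ), ∀ t : ℝ≥0,
    IntervalIntegrable
      (fun s : ℝ => weakRHS v₁ v₂ α₁₂ α₂₁ φ₁ φ₂ (m₁ s.toNNReal) (m₂ s.toNNReal)) volume 0 t ∧
    (∫ x, φ₁ x ∂(m₁ t : Measure ℝ)) + ∫ x, φ₂ x ∂(m₂ t : Measure ℝ)
      = (∫ x, φ₁ x ∂(m₁ 0 : Measure ℝ)) + (∫ x, φ₂ x ∂(m₂ 0 : Measure ℝ))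
        + ∫ s in (0 : ℝ)..(t : ℝ),
            weakRHS v₁ v₂ α₁₂ α₂₁ φ₁ φ₂ (m₁ s.toNNReal) (m₂ s.toNNReal)

end TimeSync

end

/-! Test the empirical measures against `cos (ξ ·)` and `sin (ξ ·)`. Differentiation exchanges these
functions up to a factor `±ξ`, and the jumps only mix the averages of the two types, so for each `ξ`
four averages span a space invariant under the generator (`generator_trigObs`). By Dynkin's formula
their means solve a linear system that does not depend on the particle numbers, and Grönwall's
inequality carries convergence of the means from time `0` to time `t` (`exists_tendsto_trigMean`). A
jump moves an average by `O(1/N)`, so the carré du champ is `O(1/N)`, and a second use of Grönwall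
makes the variances vanish (`sum_trigVar_le`, `tendsto_trigVar`).

The limits have to be characteristic functions of probability measures. By Lévy's theorem continuity
at `ξ = 0` is enough. At time `0` this comes from tightness, which is not assumed: if every bounded
`C¹` statistic converges, no mass escapes, by Baire's theorem applied to the functions `bumpSeries
c` (`exists_integral_tailBump_le`). Their derivatives may be unbounded, so the hypothesis is needed
for bounded `C¹` functions without a bound on the derivative. At later times continuity at `0`
follows by comparison with `(1, 0, 1, 0)`, an equilibrium of the system at frequency `0`
(`tendsto_limit_trigMean_zero`).

To reach all bounded continuous `φ`, take the mean of the empirical measure and the mean of its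
product with itself (`mixture`, `pairMixture`). Since the covariances vanish, their characteristic
functions converge to those of `m` and `m ⊗ m`; hence the first two moments of the average of `φ`
converge to those of a constant, and Chebyshev's inequality concludes
(`tendstoWeaklyInProbability_of_trig`). The weak equation is the limit of Dynkin's formula for
averages of Schwartz functions (`isWeakSolution_of_tendsto`). -/

namespace TimeSync

variable {N₁ N₂ : ℕ}

/-! ### Test functions on configuration space -/

/-- Bounded `C¹` functions on the line with bounded derivative. -/
structure IsBddC1 (φ : ℝ → ℝ) : Prop where
  contDiff : ContDiff ℝ 1 φ
  bdd : ∃ C : ℝ, ∀ x, |φ x| ≤ C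
  bdd_deriv : ∃ C : ℝ, ∀ x, |deriv φ x| ≤ C

theorem IsBddC1.hasDerivAt {φ : ℝ → ℝ} (h : IsBddC1 φ) (x : ℝ) : HasDerivAt φ (deriv φ x) x :=
  (h.contDiff.differentiable one_ne_zero x).hasDerivAt

theorem IsTestFunction.differentiable {f : Config N₁ N₂ → ℝ} (h : IsTestFunction f) :
    Differentiable ℝ f := h.1.differentiable one_ne_zero

theorem IsTestFunction.add {f g : Config N₁ N₂ → ℝ} (hf : IsTestFunction f)
    (hg : IsTestFunction g) : IsTestFunction (fun x => f x + g x) := by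
  obtain ⟨a, ha⟩ := hf.2.1
  obtain ⟨a', ha'⟩ := hf.2.2
  obtain ⟨b, hb⟩ := hg.2.1
  obtain ⟨b', hb'⟩ := hg.2.2
  refine ⟨hf.1.add hg.1, ⟨a + b, fun x => (abs_add_le _ _).trans (add_le_add (ha x) (hb x))⟩,
    ⟨a' + b', fun x => ?_⟩⟩
  rw [fderiv_fun_add (hf.differentiable x) (hg.differentiable x)]
  exact (norm_add_le _ _).trans (add_le_add (ha' x) (hb' x))

theorem IsTestFunction.mul {f g : Config N₁ N₂ → ℝ} (hf : IsTestFunction f)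
    (hg : IsTestFunction g) : IsTestFunction (fun x => f x * g x) := by
  obtain ⟨a, ha⟩ := hf.2.1
  obtain ⟨a', ha'⟩ := hf.2.2
  obtain ⟨b, hb⟩ := hg.2.1
  obtain ⟨b', hb'⟩ := hg.2.2
  have ha0 : 0 ≤ a := (abs_nonneg _).trans (ha 0)
  have hb0 : 0 ≤ b := (abs_nonneg _).trans (hb 0)
  refine ⟨hf.1.mul hg.1, ⟨a * b, fun x => ?_⟩, ⟨a * b' + b * a', fun x => ?_⟩⟩
  · rw [abs_mul]
    exact mul_le_mul (ha x) (hb x) (abs_nonneg _) ha0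
  · rw [fderiv_fun_mul (hf.differentiable x) (hg.differentiable x)]
    refine (norm_add_le _ _).trans (add_le_add ?_ ?_)
    · rw [norm_smul]
      exact mul_le_mul (ha x) (hb' x) (norm_nonneg _) ha0
    · rw [norm_smul]
      exact mul_le_mul (hb x) (ha' x) (norm_nonneg _) hb0

theorem isTestFunction_const (c : ℝ) : IsTestFunction (fun _ : Config N₁ N₂ => c) :=
  ⟨contDiff_const, ⟨|c|, fun _ => le_rfl⟩, ⟨0, fun x => by simp⟩⟩

theorem isTestFunction_sum {ι : Type*} (s : Finset ι) {f : ι → Config N₁ N₂ → ℝ}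
    (hf : ∀ i, IsTestFunction (f i)) : IsTestFunction (fun x => ∑ i ∈ s, f i x) := by
  classical
  induction s using Finset.induction_on with
  | empty => simpa using isTestFunction_const 0
  | insert i s his ih => simpa [Finset.sum_insert his] using (hf i).add ih

theorem isTestFunction_comp_clm (L : Config N₁ N₂ →L[ℝ] ℝ) {φ : ℝ → ℝ} (hφ : IsBddC1 φ) :
    IsTestFunction (fun x => φ (L x)) := by
  obtain ⟨a, ha⟩ := hφ.bdd
  obtain ⟨b, hb⟩ := hφ.bdd_deriv
  refine ⟨hφ.contDiff.comp L.contDiff, ⟨a, fun x => ha _⟩, ⟨b * ‖L‖, fun x => ?_⟩⟩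
  have h : HasFDerivAt (fun x => φ (L x)) (deriv φ (L x) • L) x :=
    (hφ.hasDerivAt (L x)).comp_hasFDerivAt x L.hasFDerivAt
  rw [h.fderiv, norm_smul]
  exact mul_le_mul_of_nonneg_right (hb _) (norm_nonneg _)

/-- Evaluation of the `i`-th coordinate of type `1`. -/
noncomputable def coord₁ (N₂ : ℕ) (i : Fin N₁) : Config N₁ N₂ →L[ℝ] ℝ :=
  (ContinuousLinearMap.proj i).comp (ContinuousLinearMap.fst ℝ (Fin N₁ → ℝ) (Fin N₂ → ℝ))

/-- Evaluation of the `j`-th coordinate of type `2`. -/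
noncomputable def coord₂ (N₁ : ℕ) (j : Fin N₂) : Config N₁ N₂ →L[ℝ] ℝ :=
  (ContinuousLinearMap.proj j).comp (ContinuousLinearMap.snd ℝ (Fin N₁ → ℝ) (Fin N₂ → ℝ))

/-! ### Empirical averages and their generator -/

/-- The mean value of `φ` over finitely many points. -/
noncomputable def avg {N : ℕ} (φ : ℝ → ℝ) (y : Fin N → ℝ) : ℝ := (N : ℝ)⁻¹ * ∑ k, φ (y k)

theorem integral_empiricalMeasure {N : ℕ} (φ : ℝ → ℝ) (y : Fin N → ℝ) :
    ∫ x, φ x ∂(empiricalMeasure y) = avg φ y := by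
  unfold empiricalMeasure avg
  rw [integral_smul_measure, integral_finsetSum_measure]
  · simp
  · intro i _
    exact integrable_dirac (by simp)

theorem abs_avg_le {N : ℕ} {φ : ℝ → ℝ} {C : ℝ} (hC : ∀ x, |φ x| ≤ C) (y : Fin N → ℝ) :
    |avg φ y| ≤ C := by
  have hC0 : 0 ≤ C := (abs_nonneg _).trans (hC 0)
  unfold avg
  rw [abs_mul, abs_of_nonneg (by positivity)]
  have h : |∑ k, φ (y k)| ≤ N * C := by
    refine (Finset.abs_sum_le_sum_abs _ _).trans ((Finset.sum_le_sum fun k _ => hC (y k)).trans ?_)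
    simp
  rcases Nat.eq_zero_or_pos N with rfl | hN
  · simpa using hC0
  · have : (0 : ℝ) < N := by exact_mod_cast hN
    calc (N : ℝ)⁻¹ * |∑ k, φ (y k)| ≤ (N : ℝ)⁻¹ * (N * C) := by gcongr
      _ = C := by field_simp

theorem continuous_avg {N : ℕ} {φ : ℝ → ℝ} (hφ : Continuous φ) :
    Continuous (fun y : Fin N → ℝ => avg φ y) := by
  unfold avg
  fun_prop

theorem avg_const_mul {N : ℕ} (c : ℝ) (φ : ℝ → ℝ) (y : Fin N → ℝ) :
    avg (fun x => c * φ x) y = c * avg φ y := by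
  simp only [avg, ← Finset.mul_sum]
  ring

theorem isTestFunction_avg₁ {φ : ℝ → ℝ} (hφ : IsBddC1 φ) :
    IsTestFunction (fun x : Config N₁ N₂ => avg φ x.1) :=
  (isTestFunction_const _).mul
    (isTestFunction_sum _ fun i => isTestFunction_comp_clm (coord₁ N₂ i) hφ)

theorem isTestFunction_avg₂ {φ : ℝ → ℝ} (hφ : IsBddC1 φ) :
    IsTestFunction (fun x : Config N₁ N₂ => avg φ x.2) :=
  (isTestFunction_const _).mul
    (isTestFunction_sum _ fun j => isTestFunction_comp_clm (coord₂ N₁ j) hφ)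

theorem fderiv_avg₁ {φ : ℝ → ℝ} (hφ : IsBddC1 φ) (v₁ v₂ : ℝ) (x : Config N₁ N₂) :
    fderiv ℝ (fun x : Config N₁ N₂ => avg φ x.1) x ((fun _ => v₁), (fun _ => v₂))
      = v₁ * avg (deriv φ) x.1 := by
  have h : HasFDerivAt (fun x : Config N₁ N₂ => avg φ x.1)
      ((N₁ : ℝ)⁻¹ • ∑ i, deriv φ (x.1 i) • coord₁ N₂ i) x := by
    refine HasFDerivAt.const_mul (HasFDerivAt.fun_sum fun i _ => ?_) _
    exact (hφ.hasDerivAt (x.1 i)).comp_hasFDerivAt x (coord₁ N₂ i).hasFDerivAt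
  rw [h.fderiv]
  simp [coord₁, avg, ← Finset.sum_mul]
  ring

theorem fderiv_avg₂ {φ : ℝ → ℝ} (hφ : IsBddC1 φ) (v₁ v₂ : ℝ) (x : Config N₁ N₂) :
    fderiv ℝ (fun x : Config N₁ N₂ => avg φ x.2) x ((fun _ => v₁), (fun _ => v₂))
      = v₂ * avg (deriv φ) x.2 := by
  have h : HasFDerivAt (fun x : Config N₁ N₂ => avg φ x.2)
      ((N₂ : ℝ)⁻¹ • ∑ i, deriv φ (x.2 i) • coord₂ N₁ i) x := by
    refine HasFDerivAt.const_mul (HasFDerivAt.fun_sum fun i _ => ?_) _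
    exact (hφ.hasDerivAt (x.2 i)).comp_hasFDerivAt x (coord₂ N₁ i).hasFDerivAt
  rw [h.fderiv]
  simp [coord₂, avg, ← Finset.sum_mul]
  ring

/-- The factor `N⁻¹` is the source of the law of large numbers: squared and summed over the jumps,
it makes the carré du champ of an average `O(1/N)`. -/
theorem avg_update {N : ℕ} (φ : ℝ → ℝ) (y : Fin N → ℝ) (i : Fin N) (a : ℝ) :
    avg φ (Function.update y i a) - avg φ y = (N : ℝ)⁻¹ * (φ a - φ (y i)) := by
  unfold avg
  rw [← mul_sub, ← Finset.sum_sub_distrib, Finset.sum_eq_single i]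
  · simp
  · intro k _ hk
    simp [Function.update_of_ne hk]
  · simp

/-- Type `2` jumps leave the average unchanged. A type `1` particle jumps to a uniformly chosen type
`2` particle at total rate `α₁₂`, so the double sum collapses to a difference of averages: the
expression is linear in the two empirical measures. -/
theorem generator_avg₁ (v₁ v₂ α₁₂ α₂₁ : ℝ) (hN₁ : 0 < N₁) (hN₂ : 0 < N₂) {φ : ℝ → ℝ}
    (hφ : IsBddC1 φ) (x : Config N₁ N₂) :
    generator v₁ v₂ α₁₂ α₂₁ (fun x : Config N₁ N₂ => avg φ x.1) x
      = v₁ * avg (deriv φ) x.1 + α₁₂ * (avg φ x.2 - avg φ x.1) := by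
  have h₁ : (N₁ : ℝ) ≠ 0 := by positivity
  have h₂ : (N₂ : ℝ) ≠ 0 := by positivity
  unfold generator
  rw [fderiv_avg₁ hφ]
  simp only [jump₁₂, jump₂₁, avg_update, sub_self, mul_zero, Finset.sum_const_zero, add_zero]
  simp only [← Finset.mul_sum, Finset.sum_sub_distrib, Finset.sum_const, Finset.card_univ,
    Fintype.card_fin, nsmul_eq_mul]
  unfold avg
  field_simp

theorem generator_avg₂ (v₁ v₂ α₁₂ α₂₁ : ℝ) (hN₁ : 0 < N₁) (hN₂ : 0 < N₂) {φ : ℝ → ℝ}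
    (hφ : IsBddC1 φ) (x : Config N₁ N₂) :
    generator v₁ v₂ α₁₂ α₂₁ (fun x : Config N₁ N₂ => avg φ x.2) x
      = v₂ * avg (deriv φ) x.2 + α₂₁ * (avg φ x.1 - avg φ x.2) := by
  have h₁ : (N₁ : ℝ) ≠ 0 := by positivity
  have h₂ : (N₂ : ℝ) ≠ 0 := by positivity
  unfold generator
  rw [fderiv_avg₂ hφ]
  simp only [jump₁₂, jump₂₁, avg_update, sub_self, mul_zero, Finset.sum_const_zero, add_zero]
  simp only [← Finset.mul_sum, Finset.sum_sub_distrib, Finset.sum_const, Finset.card_univ,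
    Fintype.card_fin, nsmul_eq_mul]
  unfold avg
  field_simp

/-! ### Carré du champ -/

/-- The carré du champ `L(f²) - 2 f L f` of the particle system. -/
noncomputable def carreDuChamp (α₁₂ α₂₁ : ℝ) (f : Config N₁ N₂ → ℝ) (x : Config N₁ N₂) : ℝ :=
  ∑ i : Fin N₁, ∑ j : Fin N₂, α₁₂ / (N₂ : ℝ) * (f (jump₁₂ x i j) - f x) ^ 2
    + ∑ j : Fin N₂, ∑ i : Fin N₁, α₂₁ / (N₁ : ℝ) * (f (jump₂₁ x j i) - f x) ^ 2

/-- The drift part is a derivation and contributes only to the first summand; each jump contributes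
through `u² - w² = 2w(u - w) + (u - w)²`. -/
theorem generator_sq (v₁ v₂ α₁₂ α₂₁ : ℝ) {f : Config N₁ N₂ → ℝ} (hf : IsTestFunction f)
    (x : Config N₁ N₂) :
    generator v₁ v₂ α₁₂ α₂₁ (fun x => f x * f x) x
      = 2 * f x * generator v₁ v₂ α₁₂ α₂₁ f x + carreDuChamp α₁₂ α₂₁ f x := by
  unfold generator carreDuChamp
  rw [fderiv_fun_mul (hf.differentiable x) (hf.differentiable x)]
  simp only [mul_add, Finset.mul_sum]
  have h (a b c d e d' e' u w : ℝ) (h₁ : d = d' + u) (h₂ : e = e' + w)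
      (h₀ : a = b) : a + d + e = b + d' + e' + (u + w) := by linarith
  refine h _ _ 0 _ _ _ _ _ _ ?_ ?_ ?_
  · simp only [← Finset.sum_add_distrib]
    exact Finset.sum_congr rfl fun i _ => Finset.sum_congr rfl fun j _ => by ring
  · simp only [← Finset.sum_add_distrib]
    exact Finset.sum_congr rfl fun i _ => Finset.sum_congr rfl fun j _ => by ring
  · simp
    ring

theorem sq_sub_le {a b C : ℝ} (ha : |a| ≤ C) (hb : |b| ≤ C) : (a - b) ^ 2 ≤ 4 * C ^ 2 := by
  rw [abs_le] at ha hb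
  nlinarith [abs_nonneg a]

/-- There are `m * n` terms, each at most `(α / n) * m⁻² * 4C²`, which leaves one factor `m⁻¹`. -/
theorem sum_sum_const_le {m n : ℕ} (hm : 0 < m) (hn : 0 < n) {α C : ℝ} (hα : 0 ≤ α)
    {g : Fin m → Fin n → ℝ} (hg : ∀ i j, |g i j| ≤ 4 * C ^ 2) :
    |∑ i : Fin m, ∑ j : Fin n, α / (n : ℝ) * (((m : ℝ)⁻¹) ^ 2 * g i j)|
      ≤ 4 * α * C ^ 2 * (m : ℝ)⁻¹ := by
  have h₁ : (0 : ℝ) < m := by positivity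
  have h₂ : (0 : ℝ) < n := by positivity
  calc |∑ i : Fin m, ∑ j : Fin n, α / (n : ℝ) * (((m : ℝ)⁻¹) ^ 2 * g i j)|
      ≤ ∑ i : Fin m, ∑ j : Fin n, α / (n : ℝ) * (((m : ℝ)⁻¹) ^ 2 * (4 * C ^ 2)) := by
        refine (Finset.abs_sum_le_sum_abs _ _).trans (Finset.sum_le_sum fun i _ => ?_)
        refine (Finset.abs_sum_le_sum_abs _ _).trans (Finset.sum_le_sum fun j _ => ?_)
        rw [abs_mul, abs_mul, abs_of_nonneg (by positivity : 0 ≤ α / (n : ℝ)),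
          abs_of_nonneg (by positivity : 0 ≤ ((m : ℝ)⁻¹) ^ 2)]
        have := hg i j
        gcongr
    _ = 4 * α * C ^ 2 * (m : ℝ)⁻¹ := by
        simp only [Finset.sum_const, Finset.card_univ, Fintype.card_fin, nsmul_eq_mul]
        field_simp

theorem abs_carreDuChamp_avg₁_le {α₁₂ α₂₁ : ℝ} (hα : 0 ≤ α₁₂) (hN₁ : 0 < N₁) (hN₂ : 0 < N₂)
    {φ : ℝ → ℝ} {C : ℝ} (hC : ∀ x, |φ x| ≤ C) (x : Config N₁ N₂) :
    |carreDuChamp α₁₂ α₂₁ (fun x : Config N₁ N₂ => avg φ x.1) x|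
      ≤ 4 * α₁₂ * C ^ 2 * (N₁ : ℝ)⁻¹ := by
  unfold carreDuChamp
  simp only [jump₁₂, jump₂₁, avg_update, sub_self, ne_eq, OfNat.ofNat_ne_zero, not_false_eq_true,
    zero_pow, mul_zero, Finset.sum_const_zero, add_zero, mul_pow]
  refine sum_sum_const_le hN₁ hN₂ hα fun i j => ?_
  rw [abs_of_nonneg (sq_nonneg _)]
  exact sq_sub_le (hC _) (hC _)

theorem abs_carreDuChamp_avg₂_le {α₁₂ α₂₁ : ℝ} (hα : 0 ≤ α₂₁) (hN₁ : 0 < N₁) (hN₂ : 0 < N₂)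
    {φ : ℝ → ℝ} {C : ℝ} (hC : ∀ x, |φ x| ≤ C) (x : Config N₁ N₂) :
    |carreDuChamp α₁₂ α₂₁ (fun x : Config N₁ N₂ => avg φ x.2) x|
      ≤ 4 * α₂₁ * C ^ 2 * (N₂ : ℝ)⁻¹ := by
  unfold carreDuChamp
  simp only [jump₁₂, jump₂₁, avg_update, sub_self, ne_eq, OfNat.ofNat_ne_zero, not_false_eq_true,
    zero_pow, mul_zero, Finset.sum_const_zero, zero_add, mul_pow]
  refine sum_sum_const_le hN₂ hN₁ hα fun i j => ?_
  rw [abs_of_nonneg (sq_nonneg _)]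
  exact sq_sub_le (hC _) (hC _)

/-! ### Continuity and boundedness of the generator applied to a test function -/

theorem continuous_jump₁₂ (i : Fin N₁) (j : Fin N₂) :
    Continuous (fun x : Config N₁ N₂ => jump₁₂ x i j) := by
  unfold jump₁₂
  fun_prop

theorem continuous_jump₂₁ (j : Fin N₂) (i : Fin N₁) :
    Continuous (fun x : Config N₁ N₂ => jump₂₁ x j i) := by
  unfold jump₂₁
  fun_prop

theorem IsTestFunction.continuous_generator {f : Config N₁ N₂ → ℝ} (hf : IsTestFunction f)
    (v₁ v₂ α₁₂ α₂₁ : ℝ) : Continuous (generator v₁ v₂ α₁₂ α₂₁ f) := by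
  have h : Continuous (fderiv ℝ f) := hf.1.continuous_fderiv one_ne_zero
  have hc := hf.1.continuous
  unfold generator
  refine ((h.clm_apply continuous_const).add ?_).add ?_
  · exact continuous_finsetSum _ fun i _ => continuous_finsetSum _ fun j _ =>
      continuous_const.mul ((hc.comp (continuous_jump₁₂ i j)).sub hc)
  · exact continuous_finsetSum _ fun i _ => continuous_finsetSum _ fun j _ =>
      continuous_const.mul ((hc.comp (continuous_jump₂₁ i j)).sub hc)

theorem exists_abs_sum_sum_le {ι κ X : Type*} [Fintype ι] [Fintype κ] {g : ι → κ → X → ℝ}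
    (hg : ∀ i j, ∃ C, ∀ x, |g i j x| ≤ C) : ∃ C, ∀ x, |∑ i, ∑ j, g i j x| ≤ C := by
  choose C hC using hg
  refine ⟨∑ i, ∑ j, C i j, fun x => ?_⟩
  refine (Finset.abs_sum_le_sum_abs _ _).trans (Finset.sum_le_sum fun i _ => ?_)
  exact (Finset.abs_sum_le_sum_abs _ _).trans (Finset.sum_le_sum fun j _ => hC i j x)

theorem IsTestFunction.exists_abs_generator_le {f : Config N₁ N₂ → ℝ} (hf : IsTestFunction f)
    (v₁ v₂ α₁₂ α₂₁ : ℝ) : ∃ C, ∀ x, |generator v₁ v₂ α₁₂ α₂₁ f x| ≤ C := by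
  obtain ⟨a, ha⟩ := hf.2.1
  obtain ⟨b, hb⟩ := hf.2.2
  have hd (c : ℝ) (x y : Config N₁ N₂) : |c * (f y - f x)| ≤ |c| * (a + a) := by
    rw [abs_mul]
    exact mul_le_mul_of_nonneg_left ((abs_sub _ _).trans (add_le_add (ha _) (ha _)))
      (abs_nonneg _)
  obtain ⟨c₁, hc₁⟩ := exists_abs_sum_sum_le (ι := Fin N₁) (κ := Fin N₂)
    (g := fun i j x => α₁₂ / (N₂ : ℝ) * (f (jump₁₂ x i j) - f x)) fun i j => ⟨_, fun x => hd _ _ _⟩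
  obtain ⟨c₂, hc₂⟩ := exists_abs_sum_sum_le (ι := Fin N₂) (κ := Fin N₁)
    (g := fun j i x => α₂₁ / (N₁ : ℝ) * (f (jump₂₁ x j i) - f x)) fun i j => ⟨_, fun x => hd _ _ _⟩
  refine ⟨b * ‖((fun _ => v₁, fun _ => v₂) : Config N₁ N₂)‖ + c₁ + c₂, fun x => ?_⟩
  refine (abs_add_le _ _).trans (add_le_add ((abs_add_le _ _).trans (add_le_add ?_ (hc₁ x))) (hc₂ x))
  exact ((fderiv ℝ f x).le_opNorm _).trans (mul_le_mul_of_nonneg_right (hb x) (norm_nonneg _))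

/-! ### Joint measurability of right-continuous processes -/

section RightContinuous

/-- The point of the grid `(n + 1)⁻¹ ℕ` next to the right of `s`. -/
noncomputable def gridRight (n : ℕ) (s : ℝ≥0) : ℝ≥0 := ((⌊s * (n + 1)⌋₊ : ℝ≥0) + 1) / (n + 1)

theorem le_gridRight (n : ℕ) (s : ℝ≥0) : s ≤ gridRight n s := by
  unfold gridRight
  rw [le_div_iff₀ (by positivity)]
  exact (Nat.lt_floor_add_one _).le

theorem gridRight_le (n : ℕ) (s : ℝ≥0) : gridRight n s ≤ s + 1 / (n + 1) := by
  unfold gridRight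
  rw [add_div]
  gcongr
  rw [div_le_iff₀ (by positivity)]
  exact Nat.floor_le (by positivity)

theorem tendsto_gridRight (s : ℝ≥0) : Tendsto (fun n => gridRight n s) atTop (𝓝[≥] s) := by
  refine tendsto_nhdsWithin_iff.2 ⟨?_, Eventually.of_forall fun n => le_gridRight n s⟩
  have h : Tendsto (fun n : ℕ => s + 1 / ((n : ℝ≥0) + 1)) atTop (𝓝 s) := by
    simpa using tendsto_const_nhds.add (tendsto_one_div_add_atTop_nhds_zero_nat (𝕜 := ℝ≥0))
  exact tendsto_of_tendsto_of_tendsto_of_le_of_le tendsto_const_nhds h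
    (fun n => le_gridRight n s) (fun n => gridRight_le n s)

/-- Evaluating at the grid point to the right of `s` gives a jointly measurable map, since only
countably many times occur. By right continuity these maps converge pointwise to the process. This
is what Fubini's theorem needs in Dynkin's formula. -/
theorem measurable_uncurry_of_rightContinuous {Ω E : Type*} [MeasurableSpace Ω]
    [TopologicalSpace E] [TopologicalSpace.PseudoMetrizableSpace E] [MeasurableSpace E]
    [BorelSpace E] {X : ℝ≥0 → Ω → E} (hX : ∀ t, Measurable (X t))
    (hc : ∀ ω t, ContinuousWithinAt (fun s => X s ω) (Set.Ici t) t) :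
    Measurable (fun p : ℝ≥0 × Ω => X p.1 p.2) := by
  have hlim (p : ℝ≥0 × Ω) :
      Tendsto (fun n => X (gridRight n p.1) p.2) atTop (𝓝 (X p.1 p.2)) := by
    have h : Tendsto (fun s => X s p.2) (𝓝[≥] p.1) (𝓝 (X p.1 p.2)) := hc p.2 p.1
    exact h.comp (tendsto_gridRight p.1)
  have hl : Tendsto (fun n (p : ℝ≥0 × Ω) => X (gridRight n p.1) p.2) atTop
      (𝓝 fun p => X p.1 p.2) := by
    rw [tendsto_pi_nhds]
    exact hlim
  refine measurable_of_tendsto_metrizable (fun n => ?_) hl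
  have h₀ : Measurable (fun s : ℝ≥0 => ⌊s * ((n : ℝ≥0) + 1)⌋₊) :=
    Nat.measurable_floor.comp (measurable_id.mul_const _)
  have key (h : ℕ → ℝ≥0) : Measurable (fun q : ℕ × Ω => X (h q.1) q.2) :=
    measurable_from_prod_countable_right fun k => hX (h k)
  have comp (d : ℝ≥0 → ℕ) (hd : Measurable d) (h : ℕ → ℝ≥0) :
      Measurable (fun p : ℝ≥0 × Ω => X (h (d p.1)) p.2) :=
    (key h).comp ((hd.comp measurable_fst).prodMk measurable_snd)
  exact comp _ h₀ fun k => ((k : ℝ≥0) + 1) / (n + 1)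

end RightContinuous

/-! ### Dynkin's formula -/

namespace IsParticleSystem

variable {v₁ v₂ α₁₂ α₂₁ : ℝ} {N₁ N₂ : ℕ} {Ω : Type*} {mΩ : MeasurableSpace Ω} {P : Measure Ω}
  {𝓕 : Filtration ℝ≥0 mΩ} {X : ℝ≥0 → Ω → Config N₁ N₂}

theorem measurable (hX : IsParticleSystem v₁ v₂ α₁₂ α₂₁ P 𝓕 X) (t : ℝ≥0) : Measurable (X t) :=
  (hX.adapted t).mono (𝓕.le t) le_rfl

theorem measurable_uncurry (hX : IsParticleSystem v₁ v₂ α₁₂ α₂₁ P 𝓕 X) :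
    Measurable (fun p : ℝ≥0 × Ω => X p.1 p.2) :=
  measurable_uncurry_of_rightContinuous hX.measurable fun ω t => ((hX.cadlag ω) t).1

variable [IsProbabilityMeasure P]

theorem integrable_comp (hX : IsParticleSystem v₁ v₂ α₁₂ α₂₁ P 𝓕 X) {g : Config N₁ N₂ → ℝ}
    (hg : Continuous g) {C : ℝ} (hC : ∀ x, |g x| ≤ C) (t : ℝ≥0) :
    Integrable (fun ω => g (X t ω)) P :=
  Integrable.of_bound (hg.measurable.comp (hX.measurable t)).aestronglyMeasurable C
    (ae_of_all _ fun _ => hC _)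

theorem abs_integral_comp_le {g : Config N₁ N₂ → ℝ} {C : ℝ} (hC : ∀ x, |g x| ≤ C) (t : ℝ≥0) :
    |∫ ω, g (X t ω) ∂P| ≤ C := by
  simpa using norm_integral_le_of_norm_le_const (μ := P) (f := fun ω => g (X t ω)) (C := C)
    (ae_of_all _ fun _ => hC _)

theorem measurable_integral_comp (hX : IsParticleSystem v₁ v₂ α₁₂ α₂₁ P 𝓕 X)
    {g : Config N₁ N₂ → ℝ} (hg : Continuous g) :
    Measurable (fun s : ℝ => ∫ ω, g (X s.toNNReal ω) ∂P) := by
  have h : Measurable (fun p : ℝ × Ω => g (X p.1.toNNReal p.2)) :=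
    hg.measurable.comp (hX.measurable_uncurry.comp
      ((measurable_real_toNNReal.comp measurable_fst).prodMk measurable_snd))
  exact h.stronglyMeasurable.integral_prod_right.measurable

theorem intervalIntegrable_integral_comp (hX : IsParticleSystem v₁ v₂ α₁₂ α₂₁ P 𝓕 X)
    {g : Config N₁ N₂ → ℝ} (hg : Continuous g) {C : ℝ} (hC : ∀ x, |g x| ≤ C) (a b : ℝ) :
    IntervalIntegrable (fun s : ℝ => ∫ ω, g (X s.toNNReal ω) ∂P) volume a b := by
  refine (intervalIntegrable_const (c := C)).mono_fun
    (hX.measurable_integral_comp hg).aestronglyMeasurable (ae_of_all _ fun s => ?_)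
  exact (abs_integral_comp_le hC _).trans (le_abs_self C)

/-- Dynkin's formula. -/
theorem integral_eq (hX : IsParticleSystem v₁ v₂ α₁₂ α₂₁ P 𝓕 X) {f : Config N₁ N₂ → ℝ}
    (hf : IsTestFunction f) (t : ℝ≥0) :
    ∫ ω, f (X t ω) ∂P = ∫ ω, f (X 0 ω) ∂P
      + ∫ s in (0 : ℝ)..t, ∫ ω, generator v₁ v₂ α₁₂ α₂₁ f (X s.toNNReal ω) ∂P := by
  obtain ⟨C, hC⟩ := hf.2.1
  obtain ⟨D, hD⟩ := hf.exists_abs_generator_le v₁ v₂ α₁₂ α₂₁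
  have hg := hf.continuous_generator v₁ v₂ α₁₂ α₂₁
  set g := generator v₁ v₂ α₁₂ α₂₁ f
  have hint := (hX.martingale f hf).integrable
  have hmean := (hX.martingale f hf).setIntegral_eq (i := 0) (j := t) t.2 MeasurableSet.univ
  have hft := hX.integrable_comp hf.1.continuous hC
  have hmeas : Measurable (fun p : ℝ × Ω => g (X p.1.toNNReal p.2)) :=
    hg.measurable.comp (hX.measurable_uncurry.comp
      ((measurable_real_toNNReal.comp measurable_fst).prodMk measurable_snd))
  have : IsFiniteMeasure ((volume : Measure ℝ).restrict (Set.uIoc 0 (t : ℝ))) :=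
    ⟨by simp [Set.uIoc]⟩
  have hprod : Integrable (Function.uncurry fun (s : ℝ) ω => g (X s.toNNReal ω))
      ((volume.restrict (Set.uIoc 0 (t : ℝ))).prod P) :=
    Integrable.of_bound hmeas.aestronglyMeasurable D (ae_of_all _ fun p => hD _)
  have hswap := intervalIntegral_integral_swap hprod
  simp only [NNReal.coe_zero, intervalIntegral.integral_same, sub_self, setIntegral_univ,
    integral_zero] at hmean
  -- The martingale is integrable and so are the two values of `f`; hence so is the time integral,
  -- which is their difference.
  have hI : Integrable (fun ω => ∫ s in (0 : ℝ)..t, g (X s.toNNReal ω)) P := by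
    refine (((hft t).sub (hft 0)).sub (hint t)).congr (ae_of_all _ fun ω => ?_)
    simp [g]
  have hsub : Integrable (fun ω => f (X t ω) - f (X 0 ω)) P := (hft t).sub (hft 0)
  rw [integral_sub hsub hI, integral_sub (hft t) (hft 0)] at hmean
  rw [hswap]
  linarith

/-- Paths jump, but by Dynkin's formula the mean is a constant plus the primitive of a bounded
function. -/
theorem continuous_integral (hX : IsParticleSystem v₁ v₂ α₁₂ α₂₁ P 𝓕 X)
    {f : Config N₁ N₂ → ℝ} (hf : IsTestFunction f) :
    Continuous (fun s : ℝ => ∫ ω, f (X s.toNNReal ω) ∂P) := by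
  obtain ⟨D, hD⟩ := hf.exists_abs_generator_le v₁ v₂ α₁₂ α₂₁
  have hi := hX.intervalIntegrable_integral_comp (hf.continuous_generator v₁ v₂ α₁₂ α₂₁) hD
  have h := intervalIntegral.continuous_primitive hi 0
  have := (continuous_const (y := ∫ ω, f (X 0 ω) ∂P)).add
    (h.comp (continuous_subtype_val.comp continuous_real_toNNReal))
  refine this.congr fun s => ?_
  exact (hX.integral_eq hf _).symm

end IsParticleSystem

/-! ### Grönwall estimates -/

/-- Grönwall's inequality in integral form for the `ℓ¹` norm of finitely many functions. -/
theorem sum_abs_le_of_integral_eq {ι : Type*} [Fintype ι] {u h : ι → ℝ → ℝ} {T C b : ℝ}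
    (hT : 0 ≤ T) (hC : 0 ≤ C) (hb : 0 ≤ b) (hu : ∀ k, Continuous (u k))
    (hint : ∀ k t, IntervalIntegrable (h k) volume 0 t)
    (heq : ∀ k, ∀ t, 0 ≤ t → u k t = u k 0 + ∫ s in (0 : ℝ)..t, h k s)
    (hle : ∀ k, ∀ s, 0 ≤ s → |h k s| ≤ C * ∑ l, |u l s| + b) :
    ∑ k, |u k T|
      ≤ (∑ k, |u k 0| + Fintype.card ι * b * T) * Real.exp (Fintype.card ι * C * T) := by
  set d : ℝ := (Fintype.card ι : ℝ)
  have hd : 0 ≤ d := Nat.cast_nonneg _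
  set κ : ℝ → ℝ := fun s => ∑ k, |u k s| with hκ
  have hκc : Continuous κ := continuous_finsetSum _ fun k _ => (hu k).abs
  have hκ0 (s : ℝ) : 0 ≤ κ s := Finset.sum_nonneg fun k _ => abs_nonneg _
  -- The `u k` need not be differentiable, since `h k` is only integrable. The majorant `G` of `κ`
  -- is, with derivative `d * C * κ ≤ d * C * G` on `[0, T]`, so the differential form of Grönwall
  -- applies to `G`.
  set G : ℝ → ℝ := fun t => (κ 0 + d * b * T) + d * C * ∫ s in (0 : ℝ)..t, κ s with hG
  have hG' (t : ℝ) : HasDerivAt G (d * C * κ t) t := by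
    have := (hκc.integral_hasStrictDerivAt 0 t).hasDerivAt
    exact (this.const_mul (d * C)).const_add _
  have hκG : ∀ t ∈ Set.Icc 0 T, κ t ≤ G t := by
    intro t ht
    have h1 (k : ι) : |u k t| ≤ |u k 0| + ∫ s in (0 : ℝ)..t, (C * κ s + b) := by
      rw [heq k t ht.1]
      refine (abs_add_le _ _).trans (add_le_add le_rfl ?_)
      refine (intervalIntegral.abs_integral_le_integral_abs ht.1).trans ?_
      refine intervalIntegral.integral_mono_on ht.1 (hint k t).abs ?_ fun s hs => hle k s hs.1
      exact Continuous.intervalIntegrable (by fun_prop) _ _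
    have h2 : ∫ s in (0 : ℝ)..t, (C * κ s + b) = C * (∫ s in (0 : ℝ)..t, κ s) + b * t := by
      rw [intervalIntegral.integral_add (Continuous.intervalIntegrable (by fun_prop) _ _)
        (by simp), intervalIntegral.integral_const_mul]
      simp [mul_comm]
    calc κ t ≤ ∑ k, (|u k 0| + (C * (∫ s in (0 : ℝ)..t, κ s) + b * t)) :=
          Finset.sum_le_sum fun k _ => h2 ▸ h1 k
      _ = κ 0 + d * (C * (∫ s in (0 : ℝ)..t, κ s) + b * t) := by
          simp [Finset.sum_add_distrib, hκ, d]
          ring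
      _ ≤ G t := by
          have : d * b * t ≤ d * b * T := mul_le_mul_of_nonneg_left ht.2 (by positivity)
          simp only [hG]
          nlinarith
  have hG0 : ∀ t ∈ Set.Icc 0 T, 0 ≤ G t := fun t ht => (hκ0 t).trans (hκG t ht)
  have key := norm_le_gronwallBound_of_norm_deriv_right_le (f := G) (f' := fun t => d * C * κ t)
    (δ := κ 0 + d * b * T) (K := d * C) (ε := 0) (a := 0) (b := T)
    (fun t _ => (hG' t).continuousAt.continuousWithinAt)
    (fun t _ => (hG' t).hasDerivWithinAt)
    (by
      have : 0 ≤ κ 0 + d * b * T := add_nonneg (hκ0 0) (by positivity)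
      simp only [hG, intervalIntegral.integral_same, mul_zero, add_zero, Real.norm_eq_abs,
        abs_of_nonneg this, le_refl])
    (fun t ht => by
      have ht' : t ∈ Set.Icc 0 T := ⟨ht.1, ht.2.le⟩
      rw [Real.norm_eq_abs, Real.norm_eq_abs, abs_of_nonneg (hG0 t ht'),
        abs_of_nonneg (mul_nonneg (by positivity) (hκ0 t)), add_zero]
      exact mul_le_mul_of_nonneg_left (hκG t ht') (by positivity))
    T ⟨hT, le_rfl⟩
  rw [gronwallBound_ε0, sub_zero] at key
  exact (hκG T ⟨hT, le_rfl⟩).trans ((le_abs_self _).trans key)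

theorem sq_eq_of_integral_eq {z h : ℝ → ℝ} (hh : Continuous h)
    (heq : ∀ t, 0 ≤ t → z t = z 0 + ∫ s in (0 : ℝ)..t, h s) {t : ℝ} (ht : 0 ≤ t) :
    z t * z t = z 0 * z 0 + ∫ s in (0 : ℝ)..t, 2 * z s * h s := by
  -- The integral equation for `z` holds only for nonnegative times; `w` agrees with `z` there and
  -- is differentiable on the whole line, so the product rule can be integrated.
  set w : ℝ → ℝ := fun t => z 0 + ∫ s in (0 : ℝ)..t, h s with hw
  have hw' (t : ℝ) : HasDerivAt w (h t) t :=
    (hh.integral_hasStrictDerivAt 0 t).hasDerivAt.const_add _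
  have hwc : Continuous w := continuous_iff_continuousAt.2 fun t => (hw' t).continuousAt
  have h1 : ∫ s in (0 : ℝ)..t, (h s * w s + w s * h s) = w t * w t - w 0 * w 0 :=
    intervalIntegral.integral_eq_sub_of_hasDerivAt (fun s _ => (hw' s).mul (hw' s))
      (Continuous.intervalIntegrable (by fun_prop) _ _)
  have h2 : ∫ s in (0 : ℝ)..t, 2 * z s * h s = ∫ s in (0 : ℝ)..t, (h s * w s + w s * h s) := by
    refine intervalIntegral.integral_congr fun s hs => ?_
    rw [Set.uIcc_of_le ht] at hs
    simp only [heq s hs.1]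
    ring
  have hw0 : w 0 = z 0 := by simp [hw]
  rw [h2, h1, heq t ht, hw0]
  ring

/-! ### The linear system at a fixed frequency -/

/-- The matrix of the generator on the span of the trigonometric observables of frequency `ξ`. -/
def freqMatrix (v₁ v₂ α₁₂ α₂₁ ξ : ℝ) : Fin 4 → Fin 4 → ℝ :=
  ![![-α₁₂, -(v₁ * ξ), α₁₂, 0], ![v₁ * ξ, -α₁₂, 0, α₁₂],
    ![α₂₁, 0, -α₂₁, -(v₂ * ξ)], ![0, α₂₁, v₂ * ξ, -α₂₁]]

/-- A bound for the entries of `freqMatrix`. -/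
def freqBound (v₁ v₂ α₁₂ α₂₁ ξ : ℝ) : ℝ := |α₁₂| + |α₂₁| + (|v₁| + |v₂|) * |ξ|

theorem freqBound_nonneg (v₁ v₂ α₁₂ α₂₁ ξ : ℝ) : 0 ≤ freqBound v₁ v₂ α₁₂ α₂₁ ξ := by
  unfold freqBound
  positivity

theorem abs_freqMatrix_le (v₁ v₂ α₁₂ α₂₁ ξ : ℝ) (k l : Fin 4) :
    |freqMatrix v₁ v₂ α₁₂ α₂₁ ξ k l| ≤ freqBound v₁ v₂ α₁₂ α₂₁ ξ := by
  have h₁ := abs_nonneg α₁₂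
  have h₂ := abs_nonneg α₂₁
  have h₃ : 0 ≤ |v₁| * |ξ| := by positivity
  have h₄ : 0 ≤ |v₂| * |ξ| := by positivity
  unfold freqBound
  fin_cases k <;> fin_cases l <;> simp [freqMatrix, abs_mul] <;> nlinarith

theorem abs_sum_freqMatrix_mul_le (v₁ v₂ α₁₂ α₂₁ ξ : ℝ) (k : Fin 4) (z : Fin 4 → ℝ) :
    |∑ l, freqMatrix v₁ v₂ α₁₂ α₂₁ ξ k l * z l| ≤ freqBound v₁ v₂ α₁₂ α₂₁ ξ * ∑ l, |z l| := by
  rw [Finset.mul_sum]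
  refine (Finset.abs_sum_le_sum_abs _ _).trans (Finset.sum_le_sum fun l _ => ?_)
  rw [abs_mul]
  exact mul_le_mul_of_nonneg_right (abs_freqMatrix_le ..) (abs_nonneg _)

/-- `z` solves the linear system `z' = B(ξ) z` for `t ≥ 0`. -/
structure IsFreqSolution (v₁ v₂ α₁₂ α₂₁ ξ : ℝ) (z : Fin 4 → ℝ → ℝ) : Prop where
  continuous : ∀ k, Continuous (z k)
  eq : ∀ k t, 0 ≤ t →
    z k t = z k 0 + ∫ s in (0 : ℝ)..t, ∑ l, freqMatrix v₁ v₂ α₁₂ α₂₁ ξ k l * z l s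

namespace IsFreqSolution

variable {v₁ v₂ α₁₂ α₂₁ ξ : ℝ} {z w : Fin 4 → ℝ → ℝ}

theorem continuous_rhs (hz : IsFreqSolution v₁ v₂ α₁₂ α₂₁ ξ z) (k : Fin 4) :
    Continuous (fun s => ∑ l, freqMatrix v₁ v₂ α₁₂ α₂₁ ξ k l * z l s) :=
  continuous_finsetSum _ fun l _ => continuous_const.mul (hz.continuous l)

/-- The difference of two solutions solves the same homogeneous system, so Grönwall applies with `b
= 0`; the `4` in the exponent is the dimension. -/
theorem sum_abs_sub_le (hz : IsFreqSolution v₁ v₂ α₁₂ α₂₁ ξ z)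
    (hw : IsFreqSolution v₁ v₂ α₁₂ α₂₁ ξ w) {t : ℝ} (ht : 0 ≤ t) :
    ∑ k, |z k t - w k t|
      ≤ (∑ k, |z k 0 - w k 0|) * Real.exp (4 * freqBound v₁ v₂ α₁₂ α₂₁ ξ * t) := by
  have := sum_abs_le_of_integral_eq (u := fun k s => z k s - w k s)
    (h := fun k s => ∑ l, freqMatrix v₁ v₂ α₁₂ α₂₁ ξ k l * z l s
      - ∑ l, freqMatrix v₁ v₂ α₁₂ α₂₁ ξ k l * w l s) (b := 0) ht
    (freqBound_nonneg v₁ v₂ α₁₂ α₂₁ ξ) le_rfl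
    (fun k => (hz.continuous k).sub (hw.continuous k))
    (fun k t => ((hz.continuous_rhs k).sub (hw.continuous_rhs k)).intervalIntegrable _ _)
    (fun k t ht => by
      rw [intervalIntegral.integral_sub ((hz.continuous_rhs k).intervalIntegrable _ _)
        ((hw.continuous_rhs k).intervalIntegrable _ _), hz.eq k t ht, hw.eq k t ht]
      ring)
    (fun k s _ => by
      rw [← Finset.sum_sub_distrib, add_zero]
      simp only [← mul_sub]
      exact abs_sum_freqMatrix_mul_le v₁ v₂ α₁₂ α₂₁ ξ k (fun l => z l s - w l s))
  simpa using this

/-- The vector `(1, 0, 1, 0)` is the value of the trigonometric averages at frequency `0`. It is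
annihilated by the jump part of the matrix, and the drift part moves each of its entries by at most
`(|v₁| + |v₂|) * |ξ|`. The bound controls solutions as `ξ → 0`. -/
theorem sum_abs_sub_one_le (hz : IsFreqSolution v₁ v₂ α₁₂ α₂₁ ξ z) {t : ℝ} (ht : 0 ≤ t) :
    ∑ k, |z k t - ![1, 0, 1, 0] k|
      ≤ (∑ k, |z k 0 - ![1, 0, 1, 0] k| + 4 * ((|v₁| + |v₂|) * |ξ|) * t)
        * Real.exp (4 * freqBound v₁ v₂ α₁₂ α₂₁ ξ * t) := by
  have h0 (k : Fin 4) : |∑ l, freqMatrix v₁ v₂ α₁₂ α₂₁ ξ k l * ![(1 : ℝ), 0, 1, 0] l|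
      ≤ (|v₁| + |v₂|) * |ξ| := by
    have h₃ : 0 ≤ |v₁| * |ξ| := by positivity
    have h₄ : 0 ≤ |v₂| * |ξ| := by positivity
    fin_cases k <;> simp [freqMatrix, Fin.sum_univ_four, abs_mul] <;> nlinarith
  have := sum_abs_le_of_integral_eq (u := fun k s => z k s - ![1, 0, 1, 0] k)
    (h := fun k s => ∑ l, freqMatrix v₁ v₂ α₁₂ α₂₁ ξ k l * z l s)
    (b := (|v₁| + |v₂|) * |ξ|) ht
    (freqBound_nonneg v₁ v₂ α₁₂ α₂₁ ξ) (by positivity)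
    (fun k => (hz.continuous k).sub continuous_const)
    (fun k t => (hz.continuous_rhs k).intervalIntegrable _ _)
    (fun k t ht => by
      simp only [hz.eq k t ht]
      ring)
    (fun k s _ => by
      have hs : ∑ l, freqMatrix v₁ v₂ α₁₂ α₂₁ ξ k l * z l s
          = ∑ l, freqMatrix v₁ v₂ α₁₂ α₂₁ ξ k l * (z l s - ![1, 0, 1, 0] l)
            + ∑ l, freqMatrix v₁ v₂ α₁₂ α₂₁ ξ k l * ![1, 0, 1, 0] l := by
        rw [← Finset.sum_add_distrib]
        exact Finset.sum_congr rfl fun l _ => by ring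
      rw [hs]
      exact (abs_add_le _ _).trans (add_le_add (abs_sum_freqMatrix_mul_le v₁ v₂ α₁₂ α₂₁ ξ k
        (fun l => z l s - ![1, 0, 1, 0] l)) (h0 k)))
  simpa using this

end IsFreqSolution

/-! ### Trigonometric observables -/

theorem deriv_cos_mul (ξ x : ℝ) :
    deriv (fun x => Real.cos (ξ * x)) x = -ξ * Real.sin (ξ * x) := by
  have h : HasDerivAt (fun x => Real.cos (ξ * x)) (-Real.sin (ξ * x) * (ξ * 1)) x :=
    ((hasDerivAt_id x).const_mul ξ).cos
  rw [h.deriv]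
  ring

theorem deriv_sin_mul (ξ x : ℝ) :
    deriv (fun x => Real.sin (ξ * x)) x = ξ * Real.cos (ξ * x) := by
  have h : HasDerivAt (fun x => Real.sin (ξ * x)) (Real.cos (ξ * x) * (ξ * 1)) x :=
    ((hasDerivAt_id x).const_mul ξ).sin
  rw [h.deriv]
  ring

theorem isBddC1_cos (ξ : ℝ) : IsBddC1 (fun x => Real.cos (ξ * x)) where
  contDiff := Real.contDiff_cos.comp (contDiff_const.mul contDiff_id)
  bdd := ⟨1, fun x => Real.abs_cos_le_one _⟩
  bdd_deriv := ⟨|ξ|, fun x => by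
    rw [deriv_cos_mul, abs_mul, abs_neg]
    exact mul_le_of_le_one_right (abs_nonneg _) (Real.abs_sin_le_one _)⟩

theorem isBddC1_sin (ξ : ℝ) : IsBddC1 (fun x => Real.sin (ξ * x)) where
  contDiff := Real.contDiff_sin.comp (contDiff_const.mul contDiff_id)
  bdd := ⟨1, fun x => Real.abs_sin_le_one _⟩
  bdd_deriv := ⟨|ξ|, fun x => by
    rw [deriv_sin_mul, abs_mul]
    exact mul_le_of_le_one_right (abs_nonneg _) (Real.abs_cos_le_one _)⟩

/-- The real and imaginary parts of the characteristic functions, at frequency `ξ`, of the two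
empirical measures. -/
noncomputable def trigObs {N₁ N₂ : ℕ} (ξ : ℝ) : Fin 4 → Config N₁ N₂ → ℝ :=
  ![fun x => avg (fun y => Real.cos (ξ * y)) x.1, fun x => avg (fun y => Real.sin (ξ * y)) x.1,
    fun x => avg (fun y => Real.cos (ξ * y)) x.2, fun x => avg (fun y => Real.sin (ξ * y)) x.2]

section TrigObs

variable {N₁ N₂ : ℕ}

theorem isTestFunction_trigObs (ξ : ℝ) (k : Fin 4) :
    IsTestFunction (trigObs ξ k : Config N₁ N₂ → ℝ) := by
  fin_cases k
  · exact isTestFunction_avg₁ (isBddC1_cos ξ)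
  · exact isTestFunction_avg₁ (isBddC1_sin ξ)
  · exact isTestFunction_avg₂ (isBddC1_cos ξ)
  · exact isTestFunction_avg₂ (isBddC1_sin ξ)

theorem abs_trigObs_le (ξ : ℝ) (k : Fin 4) (x : Config N₁ N₂) : |trigObs ξ k x| ≤ 1 := by
  fin_cases k
  · exact abs_avg_le (fun y => Real.abs_cos_le_one _) _
  · exact abs_avg_le (fun y => Real.abs_sin_le_one _) _
  · exact abs_avg_le (fun y => Real.abs_cos_le_one _) _
  · exact abs_avg_le (fun y => Real.abs_sin_le_one _) _

/-- Closure of the moment equations: the drift rotates cosine into sine within one type, and the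
jumps couple equal functions of the two types. -/
theorem generator_trigObs (v₁ v₂ α₁₂ α₂₁ ξ : ℝ) (hN₁ : 0 < N₁) (hN₂ : 0 < N₂) (k : Fin 4)
    (x : Config N₁ N₂) :
    generator v₁ v₂ α₁₂ α₂₁ (trigObs ξ k) x
      = ∑ l, freqMatrix v₁ v₂ α₁₂ α₂₁ ξ k l * trigObs ξ l x := by
  have hc : deriv (fun y => Real.cos (ξ * y)) = fun y => -ξ * Real.sin (ξ * y) :=
    funext fun y => deriv_cos_mul ξ y
  have hs : deriv (fun y => Real.sin (ξ * y)) = fun y => ξ * Real.cos (ξ * y) :=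
    funext fun y => deriv_sin_mul ξ y
  fin_cases k
  · refine (generator_avg₁ v₁ v₂ α₁₂ α₂₁ hN₁ hN₂ (isBddC1_cos ξ) x).trans ?_
    rw [hc, avg_const_mul]
    simp [freqMatrix, trigObs, Fin.sum_univ_four]
    ring
  · refine (generator_avg₁ v₁ v₂ α₁₂ α₂₁ hN₁ hN₂ (isBddC1_sin ξ) x).trans ?_
    rw [hs, avg_const_mul]
    simp [freqMatrix, trigObs, Fin.sum_univ_four]
    ring
  · refine (generator_avg₂ v₁ v₂ α₁₂ α₂₁ hN₁ hN₂ (isBddC1_cos ξ) x).trans ?_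
    rw [hc, avg_const_mul]
    simp [freqMatrix, trigObs, Fin.sum_univ_four]
    ring
  · refine (generator_avg₂ v₁ v₂ α₁₂ α₂₁ hN₁ hN₂ (isBddC1_sin ξ) x).trans ?_
    rw [hs, avg_const_mul]
    simp [freqMatrix, trigObs, Fin.sum_univ_four]
    ring

theorem abs_carreDuChamp_trigObs_le {α₁₂ α₂₁ : ℝ} (hα₁₂ : 0 ≤ α₁₂) (hα₂₁ : 0 ≤ α₂₁) (ξ : ℝ)
    (hN₁ : 0 < N₁) (hN₂ : 0 < N₂) (k : Fin 4) (x : Config N₁ N₂) :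
    |carreDuChamp α₁₂ α₂₁ (trigObs ξ k) x|
      ≤ 4 * α₁₂ * (N₁ : ℝ)⁻¹ + 4 * α₂₁ * (N₂ : ℝ)⁻¹ := by
  have h₁ : 0 ≤ 4 * α₁₂ * (N₁ : ℝ)⁻¹ := by positivity
  have h₂ : 0 ≤ 4 * α₂₁ * (N₂ : ℝ)⁻¹ := by positivity
  fin_cases k
  · have := abs_carreDuChamp_avg₁_le (α₂₁ := α₂₁) hα₁₂ hN₁ hN₂
      (fun y => Real.abs_cos_le_one (ξ * y)) x
    exact this.trans (by linarith)
  · have := abs_carreDuChamp_avg₁_le (α₂₁ := α₂₁) hα₁₂ hN₁ hN₂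
      (fun y => Real.abs_sin_le_one (ξ * y)) x
    exact this.trans (by linarith)
  · have := abs_carreDuChamp_avg₂_le (α₁₂ := α₁₂) hα₂₁ hN₁ hN₂
      (fun y => Real.abs_cos_le_one (ξ * y)) x
    exact this.trans (by linarith)
  · have := abs_carreDuChamp_avg₂_le (α₁₂ := α₁₂) hα₂₁ hN₁ hN₂
      (fun y => Real.abs_sin_le_one (ξ * y)) x
    exact this.trans (by linarith)

end TrigObs

/-! ### Means and variances of the observables -/

/-- This is `|u w| ≤ u² + w²` for the centred variables. Bounding covariances by variances closes
the inequality for the variances alone, so the full covariance matrix need not be tracked. -/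
theorem abs_cov_le {Ω : Type*} {mΩ : MeasurableSpace Ω} {P : Measure Ω} [IsProbabilityMeasure P]
    {f g : Ω → ℝ} (hf : Integrable f P) (hg : Integrable g P)
    (hff : Integrable (fun ω => f ω * f ω) P) (hgg : Integrable (fun ω => g ω * g ω) P)
    (hfg : Integrable (fun ω => f ω * g ω) P) :
    |∫ ω, f ω * g ω ∂P - (∫ ω, f ω ∂P) * ∫ ω, g ω ∂P|
      ≤ (∫ ω, f ω * f ω ∂P - (∫ ω, f ω ∂P) * ∫ ω, f ω ∂P)
        + (∫ ω, g ω * g ω ∂P - (∫ ω, g ω ∂P) * ∫ ω, g ω ∂P) := by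
  set a := ∫ ω, f ω ∂P with ha
  set b := ∫ ω, g ω ∂P with hb
  have hcov (u w : Ω → ℝ) (hu : Integrable u P) (hw : Integrable w P)
      (huw : Integrable (fun ω => u ω * w ω) P) :
      ∫ ω, (u ω - ∫ x, u x ∂P) * (w ω - ∫ x, w x ∂P) ∂P
        = ∫ ω, u ω * w ω ∂P - (∫ ω, u ω ∂P) * ∫ ω, w ω ∂P ∧
      Integrable (fun ω => (u ω - ∫ x, u x ∂P) * (w ω - ∫ x, w x ∂P)) P := by
    set c := ∫ ω, u ω ∂P with hc
    set d := ∫ ω, w ω ∂P with hd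
    have e : (fun ω => (u ω - c) * (w ω - d))
        = fun ω => u ω * w ω - d * u ω - c * w ω + c * d := by
      funext ω
      ring
    have i1 : Integrable (fun ω => u ω * w ω - d * u ω) P := huw.sub (hu.const_mul d)
    have i2 : Integrable (fun ω => u ω * w ω - d * u ω - c * w ω) P := i1.sub (hw.const_mul c)
    rw [e]
    refine ⟨?_, i2.add (integrable_const _)⟩
    rw [integral_add i2 (integrable_const _), integral_sub i1 (hw.const_mul c),
      integral_sub huw (hu.const_mul d), integral_const_mul, integral_const_mul, ← hc, ← hd]
    simp
    ring
  obtain ⟨e1, i1⟩ := hcov f g hf hg hfg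
  obtain ⟨e2, i2⟩ := hcov f f hf hf hff
  obtain ⟨e3, i3⟩ := hcov g g hg hg hgg
  rw [← ha, ← hb] at e1 i1
  rw [← ha] at e2 i2
  rw [← hb] at e3 i3
  rw [← e1, ← e2, ← e3, ← integral_add i2 i3]
  refine abs_integral_le_integral_abs.trans (integral_mono i1.abs (i2.add i3) fun ω => ?_)
  simp only [abs_mul]
  rw [← abs_mul_abs_self (f ω - a), ← abs_mul_abs_self (g ω - b)]
  nlinarith [sq_nonneg (|f ω - a| - |g ω - b|), abs_nonneg (f ω - a), abs_nonneg (g ω - b),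
    mul_nonneg (abs_nonneg (f ω - a)) (abs_nonneg (g ω - b))]

section Moments

variable {N₁ N₂ : ℕ} {Ω : Type*} {mΩ : MeasurableSpace Ω}

/-- The means of the trigonometric observables. -/
noncomputable def trigMean (P : Measure Ω) (X : ℝ≥0 → Ω → Config N₁ N₂) (ξ : ℝ) (k : Fin 4)
    (s : ℝ) : ℝ := ∫ ω, trigObs ξ k (X s.toNNReal ω) ∂P

/-- The variances of the trigonometric observables. -/
noncomputable def trigVar (P : Measure Ω) (X : ℝ≥0 → Ω → Config N₁ N₂) (ξ : ℝ) (k : Fin 4)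
    (s : ℝ) : ℝ :=
  ∫ ω, trigObs ξ k (X s.toNNReal ω) * trigObs ξ k (X s.toNNReal ω) ∂P
    - trigMean P X ξ k s * trigMean P X ξ k s

namespace IsParticleSystem

variable {v₁ v₂ α₁₂ α₂₁ : ℝ} {P : Measure Ω} {𝓕 : Filtration ℝ≥0 mΩ}
  {X : ℝ≥0 → Ω → Config N₁ N₂} [IsProbabilityMeasure P]

theorem integrable_trigObs (hX : IsParticleSystem v₁ v₂ α₁₂ α₂₁ P 𝓕 X) (ξ : ℝ) (k : Fin 4)
    (t : ℝ≥0) : Integrable (fun ω => trigObs ξ k (X t ω)) P :=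
  hX.integrable_comp (isTestFunction_trigObs ξ k).1.continuous (abs_trigObs_le ξ k) t

theorem integrable_trigObs_mul (hX : IsParticleSystem v₁ v₂ α₁₂ α₂₁ P 𝓕 X) (ξ η : ℝ)
    (k l : Fin 4) (t : ℝ≥0) :
    Integrable (fun ω => trigObs ξ k (X t ω) * trigObs η l (X t ω)) P :=
  hX.integrable_comp (g := fun x => trigObs ξ k x * trigObs η l x) (C := 1)
    ((isTestFunction_trigObs ξ k).mul (isTestFunction_trigObs η l)).1.continuous
    (fun x => by
      rw [abs_mul]
      exact mul_le_one₀ (abs_trigObs_le ξ k x) (abs_nonneg _) (abs_trigObs_le η l x)) t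

theorem isFreqSolution (hX : IsParticleSystem v₁ v₂ α₁₂ α₂₁ P 𝓕 X) (hN₁ : 0 < N₁)
    (hN₂ : 0 < N₂) (ξ : ℝ) : IsFreqSolution v₁ v₂ α₁₂ α₂₁ ξ (trigMean P X ξ) where
  continuous k := hX.continuous_integral (isTestFunction_trigObs ξ k)
  eq k t ht := by
    have h := hX.integral_eq (isTestFunction_trigObs ξ k) t.toNNReal
    rw [Real.coe_toNNReal t ht] at h
    unfold trigMean
    rw [h, Real.toNNReal_zero]
    congr 1
    refine intervalIntegral.integral_congr fun s _ => ?_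
    simp only [generator_trigObs v₁ v₂ α₁₂ α₂₁ ξ hN₁ hN₂]
    rw [integral_finsetSum _ fun l _ => (hX.integrable_trigObs ξ l _).const_mul _]
    simp only [integral_const_mul]

theorem trigVar_nonneg (hX : IsParticleSystem v₁ v₂ α₁₂ α₂₁ P 𝓕 X) (ξ : ℝ) (k : Fin 4) (s : ℝ) :
    0 ≤ trigVar P X ξ k s := by
  have h := abs_cov_le (hX.integrable_trigObs ξ k s.toNNReal)
    (hX.integrable_trigObs ξ k s.toNNReal) (hX.integrable_trigObs_mul ξ ξ k k _)
    (hX.integrable_trigObs_mul ξ ξ k k _) (hX.integrable_trigObs_mul ξ ξ k k _)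
  have h' := (abs_nonneg _).trans h
  unfold trigVar trigMean
  linarith

/-- The derivative of a variance is twice a combination of covariances with coefficients from
`freqMatrix`, plus the mean carré du champ. The former is linear in the variances by `abs_cov_le`,
the latter is the small source term `γ` of Grönwall's inequality. -/
theorem sum_trigVar_le (hX : IsParticleSystem v₁ v₂ α₁₂ α₂₁ P 𝓕 X) (hN₁ : 0 < N₁)
    (hN₂ : 0 < N₂) (hα₁₂ : 0 ≤ α₁₂) (hα₂₁ : 0 ≤ α₂₁) (ξ : ℝ) {t : ℝ} (ht : 0 ≤ t) :
    ∑ k, trigVar P X ξ k t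
      ≤ (∑ k, trigVar P X ξ k 0 + 4 * (4 * α₁₂ * (N₁ : ℝ)⁻¹ + 4 * α₂₁ * (N₂ : ℝ)⁻¹) * t)
        * Real.exp (4 * (10 * freqBound v₁ v₂ α₁₂ α₂₁ ξ) * t) := by
  have hsol := hX.isFreqSolution hN₁ hN₂ ξ
  have hV0 := hX.trigVar_nonneg ξ
  have hβ := freqBound_nonneg v₁ v₂ α₁₂ α₂₁ ξ
  have htest (k : Fin 4) :=
    (isTestFunction_trigObs (N₁ := N₁) (N₂ := N₂) ξ k).mul (isTestFunction_trigObs ξ k)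
  have hcov (k l : Fin 4) (s : ℝ) :
      |∫ ω, trigObs ξ k (X s.toNNReal ω) * trigObs ξ l (X s.toNNReal ω) ∂P
        - trigMean P X ξ k s * trigMean P X ξ l s| ≤ trigVar P X ξ k s + trigVar P X ξ l s :=
    abs_cov_le (hX.integrable_trigObs ξ k s.toNNReal) (hX.integrable_trigObs ξ l s.toNNReal)
      (hX.integrable_trigObs_mul ξ ξ k k _) (hX.integrable_trigObs_mul ξ ξ l l _)
      (hX.integrable_trigObs_mul ξ ξ k l _)
  set γ := 4 * α₁₂ * (N₁ : ℝ)⁻¹ + 4 * α₂₁ * (N₂ : ℝ)⁻¹ with hγ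
  set rhs : Fin 4 → ℝ → ℝ :=
    fun k s => ∑ l, freqMatrix v₁ v₂ α₁₂ α₂₁ ξ k l * trigMean P X ξ l s with hrhs
  have hrhsc : ∀ k, Continuous (rhs k) := hsol.continuous_rhs
  set H : Fin 4 → ℝ → ℝ := fun k s =>
    ∫ ω, generator v₁ v₂ α₁₂ α₂₁ (fun x => trigObs ξ k x * trigObs ξ k x) (X s.toNNReal ω) ∂P
      - 2 * trigMean P X ξ k s * rhs k s with hH
  have hmc (k : Fin 4) : Continuous (fun s => 2 * trigMean P X ξ k s * rhs k s) :=
    (continuous_const.mul (hsol.continuous k)).mul (hrhsc k)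
  have hgi (k : Fin 4) (a b : ℝ) : IntervalIntegrable (fun s : ℝ =>
      ∫ ω, generator v₁ v₂ α₁₂ α₂₁ (fun x => trigObs ξ k x * trigObs ξ k x)
        (X s.toNNReal ω) ∂P) volume a b := by
    obtain ⟨D, hD⟩ := (htest k).exists_abs_generator_le v₁ v₂ α₁₂ α₂₁
    exact hX.intervalIntegrable_integral_comp ((htest k).continuous_generator ..) hD a b
  -- By `generator_sq` the generator of the square is `2 f L f` plus the carré du champ, and `L f`
  -- is a combination of the observables; subtracting the derivative of the squared mean turns
  -- second moments into covariances.
  have hHeq (k : Fin 4) (s : ℝ) :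
      H k s = 2 * ∑ l, freqMatrix v₁ v₂ α₁₂ α₂₁ ξ k l *
          (∫ ω, trigObs ξ k (X s.toNNReal ω) * trigObs ξ l (X s.toNNReal ω) ∂P
            - trigMean P X ξ k s * trigMean P X ξ l s)
        + ∫ ω, carreDuChamp α₁₂ α₂₁ (trigObs ξ k) (X s.toNNReal ω) ∂P := by
    obtain ⟨D, hD⟩ := (htest k).exists_abs_generator_le v₁ v₂ α₁₂ α₂₁
    have i1 := hX.integrable_comp ((htest k).continuous_generator v₁ v₂ α₁₂ α₂₁) hD s.toNNReal
    have i2 : Integrable (fun ω => 2 * ∑ l, freqMatrix v₁ v₂ α₁₂ α₂₁ ξ k l *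
        (trigObs ξ k (X s.toNNReal ω) * trigObs ξ l (X s.toNNReal ω))) P :=
      (integrable_finsetSum _ fun l _ =>
        (hX.integrable_trigObs_mul ξ ξ k l _).const_mul _).const_mul _
    have e (ω : Ω) : generator v₁ v₂ α₁₂ α₂₁ (fun x => trigObs ξ k x * trigObs ξ k x)
        (X s.toNNReal ω) - 2 * ∑ l, freqMatrix v₁ v₂ α₁₂ α₂₁ ξ k l *
        (trigObs ξ k (X s.toNNReal ω) * trigObs ξ l (X s.toNNReal ω))
        = carreDuChamp α₁₂ α₂₁ (trigObs ξ k) (X s.toNNReal ω) := by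
      rw [generator_sq _ _ _ _ (isTestFunction_trigObs ξ k), generator_trigObs _ _ _ _ _ hN₁ hN₂]
      simp only [Finset.mul_sum]
      rw [add_sub_right_comm, ← Finset.sum_sub_distrib]
      simp only [add_eq_right]
      exact Finset.sum_eq_zero fun l _ => by ring
    simp only [← e]
    rw [integral_sub i1 i2, integral_const_mul,
      integral_finsetSum _ fun l _ => (hX.integrable_trigObs_mul ξ ξ k l _).const_mul _]
    simp only [integral_const_mul, hH, hrhs, mul_sub, Finset.sum_sub_distrib, Finset.mul_sum]
    have e2 : ∑ l, 2 * trigMean P X ξ k s * (freqMatrix v₁ v₂ α₁₂ α₂₁ ξ k l * trigMean P X ξ l s)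
        = ∑ l, 2 * (freqMatrix v₁ v₂ α₁₂ α₂₁ ξ k l * (trigMean P X ξ k s * trigMean P X ξ l s)) :=
      Finset.sum_congr rfl fun l _ => by ring
    rw [e2]
    ring
  have key := sum_abs_le_of_integral_eq (u := trigVar P X ξ) (h := H)
    -- `10 = 2 * 5`: the `2` comes from differentiating a square, and the four covariances with the
    -- `k`-th observable sum to at most `4 + 1` times the total variance.
    (C := 10 * freqBound v₁ v₂ α₁₂ α₂₁ ξ) (b := γ) ht (by positivity) (by positivity)
    (fun k => (hX.continuous_integral (htest k)).sub
      ((hsol.continuous k).mul (hsol.continuous k)))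
    (fun k t => (hgi k 0 t).sub ((hmc k).intervalIntegrable _ _))
    (fun k t ht => by
      have h := hX.integral_eq (htest k) t.toNNReal
      rw [Real.coe_toNNReal t ht] at h
      have h2 := sq_eq_of_integral_eq (hrhsc k) (hsol.eq k) ht
      simp only [hH]
      rw [intervalIntegral.integral_sub (hgi k 0 t) ((hmc k).intervalIntegrable _ _)]
      simp only [trigVar]
      rw [h, h2, Real.toNNReal_zero]
      ring)
    (fun k s _ => by
      rw [hHeq]
      refine (abs_add_le _ _).trans (add_le_add ?_ ?_)
      · have hk : trigVar P X ξ k s ≤ ∑ l, |trigVar P X ξ l s| :=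
          (le_abs_self _).trans (Finset.single_le_sum (f := fun l => |trigVar P X ξ l s|)
            (fun l _ => abs_nonneg _) (Finset.mem_univ k))
        have hs : ∑ l, |∫ ω, trigObs ξ k (X s.toNNReal ω) * trigObs ξ l (X s.toNNReal ω) ∂P
            - trigMean P X ξ k s * trigMean P X ξ l s| ≤ 5 * ∑ l, |trigVar P X ξ l s| := by
          calc _ ≤ ∑ l, (trigVar P X ξ k s + |trigVar P X ξ l s|) :=
                Finset.sum_le_sum fun l _ => (hcov k l s).trans
                  (add_le_add le_rfl (le_abs_self _))
            _ ≤ _ := by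
                rw [Finset.sum_add_distrib]
                simp only [Finset.sum_const, Finset.card_univ, Fintype.card_fin, nsmul_eq_mul]
                push_cast
                linarith
        rw [abs_mul, abs_two]
        have := abs_sum_freqMatrix_mul_le v₁ v₂ α₁₂ α₂₁ ξ k (fun l =>
          ∫ ω, trigObs ξ k (X s.toNNReal ω) * trigObs ξ l (X s.toNNReal ω) ∂P
            - trigMean P X ξ k s * trigMean P X ξ l s)
        have h3 := mul_le_mul_of_nonneg_left hs hβ
        linarith
      · exact abs_integral_comp_le (abs_carreDuChamp_trigObs_le hα₁₂ hα₂₁ ξ hN₁ hN₂ k) _)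
  simpa [abs_of_nonneg (hV0 _ _)] using key

end IsParticleSystem

end Moments

/-! ### Tightness from convergence of all bounded `C¹` statistics -/

section Tightness

/-- A smooth function which vanishes for `x² ≤ k` and equals `1` for `x² ≥ k + 1`. -/
noncomputable def tailBump (k : ℕ) (x : ℝ) : ℝ := Real.smoothTransition (x ^ 2 - k)

theorem contDiff_tailBump (k : ℕ) : ContDiff ℝ 1 (tailBump k) :=
  (Real.smoothTransition.contDiff (n := 1)).comp ((contDiff_id.pow 2).sub contDiff_const)

theorem continuous_tailBump (k : ℕ) : Continuous (tailBump k) := (contDiff_tailBump k).continuous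

theorem tailBump_nonneg (k : ℕ) (x : ℝ) : 0 ≤ tailBump k x := Real.smoothTransition.nonneg _

theorem tailBump_le_one (k : ℕ) (x : ℝ) : tailBump k x ≤ 1 := Real.smoothTransition.le_one _

theorem tailBump_eq_zero {k : ℕ} {x : ℝ} (h : x ^ 2 ≤ k) : tailBump k x = 0 :=
  Real.smoothTransition.zero_of_nonpos (by linarith)

theorem tailBump_eq_one {k : ℕ} {x : ℝ} (h : (k : ℝ) + 1 ≤ x ^ 2) : tailBump k x = 1 :=
  Real.smoothTransition.one_of_one_le (by linarith)

theorem tailBump_succ_le (k : ℕ) (x : ℝ) : tailBump (k + 1) x ≤ tailBump k x := by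
  refine Real.smoothTransition.monotone ?_
  push_cast
  linarith

/-- The summand of `bumpSeries`: a bump on `k ≤ x² ≤ k + 2` if `c k` holds. -/
noncomputable def bumpTerm (c : ℕ → Bool) (k : ℕ) (x : ℝ) : ℝ :=
  if c k then tailBump k x - tailBump (k + 1) x else 0

/-- The locally finite sum of the bumps selected by `c`. -/
noncomputable def bumpSeries (c : ℕ → Bool) (x : ℝ) : ℝ :=
  ∑ k ∈ Finset.range ⌈x ^ 2⌉₊, bumpTerm c k x

theorem bumpTerm_nonneg (c : ℕ → Bool) (k : ℕ) (x : ℝ) : 0 ≤ bumpTerm c k x := by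
  unfold bumpTerm
  split_ifs
  · linarith [tailBump_succ_le k x]
  · exact le_rfl

theorem bumpTerm_le (c : ℕ → Bool) (k : ℕ) (x : ℝ) :
    bumpTerm c k x ≤ tailBump k x - tailBump (k + 1) x := by
  unfold bumpTerm
  split_ifs
  · exact le_rfl
  · linarith [tailBump_succ_le k x]

theorem contDiff_bumpTerm (c : ℕ → Bool) (k : ℕ) : ContDiff ℝ 1 (bumpTerm c k) := by
  unfold bumpTerm
  split_ifs
  · exact (contDiff_tailBump k).sub (contDiff_tailBump (k + 1))
  · exact contDiff_const

theorem bumpTerm_eq_zero (c : ℕ → Bool) {k : ℕ} {x : ℝ} (h : x ^ 2 ≤ k) : bumpTerm c k x = 0 := by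
  refine le_antisymm ((bumpTerm_le c k x).trans ?_) (bumpTerm_nonneg c k x)
  rw [tailBump_eq_zero h]
  linarith [tailBump_nonneg (k + 1) x]

theorem bumpSeries_eq (c : ℕ → Bool) {M : ℕ} {x : ℝ} (h : x ^ 2 ≤ M) :
    bumpSeries c x = ∑ k ∈ Finset.range M, bumpTerm c k x := by
  refine Finset.sum_subset (Finset.range_subset_range.2 (Nat.ceil_le.2 h)) fun k _ hk => ?_
  rw [Finset.mem_range, not_lt] at hk
  exact bumpTerm_eq_zero c (Nat.ceil_le.1 hk)

/-- Terms with `k ≥ x²` vanish, so near each point the series is a fixed finite sum of `C¹`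
functions. -/
theorem contDiff_bumpSeries (c : ℕ → Bool) : ContDiff ℝ 1 (bumpSeries c) := by
  refine contDiff_iff_contDiffAt.2 fun x₀ => ?_
  have h : ContDiff ℝ 1 (fun x => ∑ k ∈ Finset.range ⌈x₀ ^ 2 + 1⌉₊, bumpTerm c k x) :=
    ContDiff.sum fun k _ => contDiff_bumpTerm c k
  refine h.contDiffAt.congr_of_eventuallyEq ?_
  have hlt : ∀ᶠ x in 𝓝 x₀, x ^ 2 < x₀ ^ 2 + 1 :=
    (continuous_pow 2).continuousAt.eventually_lt continuousAt_const (by simp)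
  filter_upwards [hlt] with x hx
  exact bumpSeries_eq c (hx.le.trans (Nat.le_ceil _))

/-- Even with every bump selected the sum telescopes to at most `tailBump 0`. -/
theorem abs_bumpSeries_le (c : ℕ → Bool) (x : ℝ) : |bumpSeries c x| ≤ 1 := by
  unfold bumpSeries
  rw [abs_of_nonneg (Finset.sum_nonneg fun k _ => bumpTerm_nonneg c k x)]
  refine (Finset.sum_le_sum fun k _ => bumpTerm_le c k x).trans ?_
  rw [Finset.sum_range_sub' (fun k => tailBump k x)]
  linarith [tailBump_le_one 0 x, tailBump_nonneg ⌈x ^ 2⌉₊ x]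

/-- At a fixed point `x` only finitely many coordinates of `c` matter. -/
theorem continuous_bumpSeries_left (x : ℝ) : Continuous (fun c : ℕ → Bool => bumpSeries c x) := by
  unfold bumpSeries
  refine continuous_finsetSum _ fun k _ => ?_
  have h : Continuous (fun b : Bool => if b then tailBump k x - tailBump (k + 1) x else 0) :=
    continuous_of_discreteTopology
  exact h.comp (continuous_apply k)

/-- Below `K` the two coefficient sequences agree; from `K` on the difference contains every bump
and telescopes. The tail mass is thus a difference of two statistics of the family, both of which
can be placed in one cylinder of Cantor space. -/
theorem bumpSeries_sub (c : ℕ → Bool) (K : ℕ) (x : ℝ) :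
    bumpSeries (fun k => if k < K then c k else true) x
      - bumpSeries (fun k => if k < K then c k else false) x = tailBump K x := by
  have hM : x ^ 2 ≤ (max K ⌈x ^ 2⌉₊ : ℕ) :=
    (Nat.le_ceil _).trans (by exact_mod_cast le_max_right _ _)
  have hsum : ∀ M, K ≤ M → ∑ k ∈ Finset.range M,
      (bumpTerm (fun k => if k < K then c k else true) k x
        - bumpTerm (fun k => if k < K then c k else false) k x)
      = tailBump K x - tailBump M x := by
    intro M hKM
    induction M, hKM using Nat.le_induction with
    | base =>
      rw [sub_self]
      refine Finset.sum_eq_zero fun k hk => ?_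
      simp [bumpTerm, Finset.mem_range.1 hk]
    | succ M hM ih =>
      rw [Finset.sum_range_succ, ih]
      simp [bumpTerm, Nat.not_lt.2 hM]
  rw [bumpSeries_eq _ hM, bumpSeries_eq _ hM, ← Finset.sum_sub_distrib, hsum _ (le_max_left _ _),
    tailBump_eq_zero hM, sub_zero]

theorem tendsto_integral_tailBump (μ : Measure ℝ) [IsProbabilityMeasure μ] :
    Tendsto (fun K => ∫ x, tailBump K x ∂μ) atTop (𝓝 0) := by
  have h := tendsto_integral_of_dominated_convergence (μ := μ) (F := fun K x => tailBump K x)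
    (f := fun _ => 0) (fun _ => 1) (fun K => (continuous_tailBump K).aestronglyMeasurable)
    (integrable_const _)
    (fun K => ae_of_all _ fun x => by
      rw [Real.norm_of_nonneg (tailBump_nonneg K x)]
      exact tailBump_le_one K x)
    (ae_of_all _ fun x => tendsto_const_nhds.congr' (by
      filter_upwards [eventually_ge_atTop ⌈x ^ 2⌉₊] with K hK
      exact (tailBump_eq_zero (Nat.ceil_le.1 hK)).symm))
  simpa using h

/-- If the integrals of every bounded `C¹` function against a sequence of probability measures
converge, then no mass escapes to infinity.  The proof applies Baire's theorem to the Cantor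
space of coefficients of `bumpSeries`. -/
theorem exists_integral_tailBump_le {μ : ℕ → Measure ℝ} [∀ n, IsProbabilityMeasure (μ n)]
    (h : ∀ φ : ℝ → ℝ, ContDiff ℝ 1 φ → (∃ C : ℝ, ∀ x, |φ x| ≤ C) →
      ∃ a : ℝ, Tendsto (fun n => ∫ x, φ x ∂(μ n)) atTop (𝓝 a)) {δ : ℝ} (hδ : 0 < δ) :
    ∃ K N : ℕ, ∀ n ≥ N, ∫ x, tailBump K x ∂(μ n) ≤ 3 * δ := by
  have hint (n : ℕ) (c : ℕ → Bool) : Integrable (bumpSeries c) (μ n) :=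
    Integrable.of_bound (contDiff_bumpSeries c).continuous.aestronglyMeasurable 1
      (ae_of_all _ (abs_bumpSeries_le c))
  set a : ℕ → (ℕ → Bool) → ℝ := fun n c => ∫ x, bumpSeries c x ∂(μ n) with ha
  have hac (n : ℕ) : Continuous (a n) :=
    continuous_of_dominated (bound := fun _ => 1)
      (fun c => (contDiff_bumpSeries c).continuous.aestronglyMeasurable)
      (fun c => ae_of_all _ (abs_bumpSeries_le c)) (integrable_const _)
      (ae_of_all _ continuous_bumpSeries_left)
  -- Convergence for each `c` says that these closed sets cover Cantor space, so by Baire one of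
  -- them has interior: a single `N` serves a whole cylinder of coefficients.
  set F : ℕ → Set (ℕ → Bool) := fun N => {c | ∀ n ≥ N, |a n c - a N c| ≤ δ} with hF
  have hclosed (N : ℕ) : IsClosed (F N) := by
    have : F N = ⋂ n, ⋂ (_ : n ≥ N), {c | |a n c - a N c| ≤ δ} := by
      ext c
      simp [hF]
    rw [this]
    exact isClosed_iInter fun n => isClosed_iInter fun _ =>
      isClosed_le ((hac n).sub (hac N)).abs continuous_const
  have hunion : ⋃ N, F N = Set.univ := by
    refine Set.eq_univ_of_forall fun c => Set.mem_iUnion.2 ?_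
    obtain ⟨b, hb⟩ := h (bumpSeries c) (contDiff_bumpSeries c) ⟨1, abs_bumpSeries_le c⟩
    obtain ⟨N, hN⟩ := Metric.cauchySeq_iff'.1 hb.cauchySeq δ hδ
    exact ⟨N, fun n hn => (hN n hn).le⟩
  obtain ⟨N, c₀, hc₀⟩ := nonempty_interior_of_iUnion_of_closed hclosed hunion
  obtain ⟨s, ⟨y, L, rfl⟩, hyL, hsub⟩ :=
    (PiNat.isTopologicalBasis_cylinders (fun _ : ℕ => Bool)).mem_nhds_iff.1
      (isOpen_interior.mem_nhds hc₀)
  -- A cylinder constrains only the first `L` coordinates, so beyond `K ≥ L` the coefficients may be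
  -- set to all `true` or all `false`.
  have hmem (K : ℕ) (hK : L ≤ K) (b : Bool) : (fun k => if k < K then c₀ k else b) ∈ F N := by
    refine interior_subset (hsub ?_)
    rw [PiNat.mem_cylinder_iff] at hyL ⊢
    intro i hi
    simp [hi.trans_le hK, hyL i hi]
  obtain ⟨K, hKL, hK⟩ := ((eventually_ge_atTop L).and
    ((tendsto_integral_tailBump (μ N)).eventually_lt_const hδ)).exists
  have hdiff (n : ℕ) : ∫ x, tailBump K x ∂(μ n)
      = a n (fun k => if k < K then c₀ k else true)
        - a n (fun k => if k < K then c₀ k else false) := by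
    rw [ha, ← integral_sub (hint n _) (hint n _)]
    simp only [bumpSeries_sub]
  refine ⟨K, N, fun n hn => ?_⟩
  have h1 := abs_le.1 (hmem K hKL true n hn)
  have h2 := abs_le.1 (hmem K hKL false n hn)
  have h3 := hdiff N
  rw [hdiff n]
  -- Passing from `μ N` to `μ n` costs `δ` for each of the two statistics, and the tail mass of `μ
  -- N` itself is below `δ`.
  linarith [h1.2, h2.1]

/-! ### Characteristic functions near zero and Lévy's theorem -/

/-- Split at `x² = K + 1`. Outside, the integrand is at most `2` and `tailBump K` equals `1`;
inside, `|x| ≤ K + 1` and `|e^{iξx} - 1| ≤ |ξ x|`. -/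
theorem norm_charFun_sub_one_le (μ : Measure ℝ) [IsProbabilityMeasure μ] (K : ℕ) (ξ : ℝ) :
    ‖charFun μ ξ - 1‖ ≤ |ξ| * (K + 1) + 2 * ∫ x, tailBump K x ∂μ := by
  have hi : Integrable (fun x : ℝ => Complex.exp (ξ * x * Complex.I)) μ :=
    Integrable.of_bound (by fun_prop) 1 (ae_of_all _ fun x => by
      rw [← Complex.ofReal_mul, Complex.norm_exp_ofReal_mul_I])
  have ht : Integrable (tailBump K) μ :=
    Integrable.of_bound (continuous_tailBump K).aestronglyMeasurable 1 (ae_of_all _ fun x => by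
      rw [Real.norm_of_nonneg (tailBump_nonneg K x)]
      exact tailBump_le_one K x)
  have h1 : charFun μ ξ - 1 = ∫ x : ℝ, (Complex.exp (ξ * x * Complex.I) - 1) ∂μ := by
    rw [integral_sub hi (integrable_const _), charFun_apply_real]
    simp
  have hpt (x : ℝ) : ‖Complex.exp (ξ * x * Complex.I) - 1‖ ≤ |ξ| * (K + 1) + 2 * tailBump K x := by
    rcases le_total ((K : ℝ) + 1) (x ^ 2) with hx | hx
    · rw [tailBump_eq_one hx]
      have : ‖Complex.exp (ξ * x * Complex.I) - 1‖ ≤ 1 + 1 := by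
        refine (norm_sub_le _ _).trans (add_le_add ?_ (by simp))
        rw [← Complex.ofReal_mul, Complex.norm_exp_ofReal_mul_I]
      have h0 : 0 ≤ |ξ| * ((K : ℝ) + 1) := by positivity
      linarith
    · have hxK : |x| ≤ K + 1 := by
        have : (0 : ℝ) ≤ K := Nat.cast_nonneg K
        exact abs_le_of_sq_le_sq (hx.trans (by nlinarith)) (by positivity)
      have := Real.norm_exp_I_mul_ofReal_sub_one_le (x := ξ * x)
      rw [mul_comm Complex.I, Complex.ofReal_mul] at this
      refine this.trans ?_
      rw [Real.norm_eq_abs, abs_mul]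
      have h2 := mul_le_mul_of_nonneg_left hxK (abs_nonneg ξ)
      linarith [tailBump_nonneg K x]
  rw [h1]
  refine (norm_integral_le_integral_norm _).trans ((integral_mono_of_nonneg
    (ae_of_all _ fun x => norm_nonneg _) ((integrable_const _).add (ht.const_mul 2))
    (ae_of_all _ hpt)).trans_eq ?_)
  simp only [Pi.add_apply]
  rw [integral_add (integrable_const _) (ht.const_mul 2),
    show ∫ x, 2 * tailBump K x ∂μ = 2 * ∫ x, tailBump K x ∂μ from integral_const_mul _ _]
  simp

theorem continuousAt_of_tendsto_charFun {μ : ℕ → Measure ℝ} [∀ n, IsProbabilityMeasure (μ n)]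
    (h : ∀ φ : ℝ → ℝ, ContDiff ℝ 1 φ → (∃ C : ℝ, ∀ x, |φ x| ≤ C) →
      ∃ a : ℝ, Tendsto (fun n => ∫ x, φ x ∂(μ n)) atTop (𝓝 a))
    {f : ℝ → ℂ} (hf : ∀ ξ, Tendsto (fun n => charFun (μ n) ξ) atTop (𝓝 (f ξ))) :
    ContinuousAt f 0 := by
  have hf0 : f 0 = 1 := tendsto_nhds_unique (hf 0) (by simp)
  rw [Metric.continuousAt_iff]
  intro ε hε
  -- With this `δ` the tail contributes at most `2 * 3 * ε / 12 = ε / 2`, and the choice of the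
  -- radius below leaves at most `ε / 4` for the linear term.
  obtain ⟨K, N, hKN⟩ := exists_integral_tailBump_le h (δ := ε / 12) (by positivity)
  refine ⟨ε / (4 * (K + 1)), by positivity, fun ξ hξ => ?_⟩
  rw [dist_zero_right, Real.norm_eq_abs, lt_div_iff₀ (by positivity)] at hξ
  rw [hf0, dist_eq_norm]
  have hle : ‖f ξ - 1‖ ≤ 3 * ε / 4 := by
    refine le_of_tendsto ((hf ξ).sub_const 1).norm ?_
    filter_upwards [eventually_ge_atTop N] with n hn
    have := norm_charFun_sub_one_le (μ n) K ξ
    have := hKN n hn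
    linarith
  linarith

/-- Lévy's continuity theorem for a limit which is only assumed to be continuous at `0`. -/
theorem exists_tendsto_of_tendsto_charFun {μ : ℕ → ProbabilityMeasure ℝ} {f : ℝ → ℂ}
    (hf : ContinuousAt f 0)
    (h : ∀ ξ, Tendsto (fun n => charFun (μ n : Measure ℝ) ξ) atTop (𝓝 (f ξ))) :
    ∃ m : ProbabilityMeasure ℝ, Tendsto μ atTop (𝓝 m) ∧
      ∀ ξ, charFun (m : Measure ℝ) ξ = f ξ := by
  have ht : IsTightMeasureSet (Set.range fun n => (μ n : Measure ℝ)) :=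
    isTightMeasureSet_of_tendsto_charFun hf h
  have hcomp : IsCompact (closure (Set.range μ)) := by
    refine isCompact_closure_of_isTightMeasureSet (ht.subset ?_)
    rintro _ ⟨_, ⟨n, rfl⟩, rfl⟩
    exact ⟨n, rfl⟩
  -- Prokhorov supplies a cluster point. Evaluating a characteristic function at `ξ` is weakly
  -- continuous, so the cluster point has characteristic function `f`; convergence of the whole
  -- sequence then follows from that of the characteristic functions.
  obtain ⟨m, -, hm⟩ := hcomp.exists_mapClusterPt (f := atTop) (u := μ)
    (tendsto_principal.2 (Eventually.of_forall fun n => subset_closure ⟨n, rfl⟩))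
  have hchar (ξ : ℝ) : charFun (m : Measure ℝ) ξ = f ξ := by
    have hc : Continuous (fun ν : ProbabilityMeasure ℝ => charFun (ν : Measure ℝ) ξ) := by
      rw [continuous_iff_continuousAt]
      intro ν
      have := (ProbabilityMeasure.tendsto_iff_forall_integral_rclike_tendsto ℂ
        (F := 𝓝 ν) (μs := id) (μ := ν)).1 tendsto_id (BoundedContinuousFunction.innerProbChar ξ)
      simpa only [ContinuousAt, charFun_eq_integral_innerProbChar, id_eq] using this
    have hcl : MapClusterPt (charFun (m : Measure ℝ) ξ) atTop
        (fun n => charFun (μ n : Measure ℝ) ξ) := hm.continuousAt_comp hc.continuousAt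
    have : NeBot (𝓝 (charFun (m : Measure ℝ) ξ) ⊓ 𝓝 (f ξ)) :=
      NeBot.mono hcl (inf_le_inf le_rfl (h ξ))
    exact eq_of_nhds_neBot this
  refine ⟨m, ProbabilityMeasure.tendsto_of_tendsto_charFun fun ξ => ?_, hchar⟩
  rw [hchar]
  exact h ξ

end Tightness

/-! ### Mean empirical measures -/

section Mixture

variable {Ω E : Type*} {mΩ : MeasurableSpace Ω} [MeasurableSpace E]

/-- The law of `Y i` for a uniformly distributed index `i`. -/
noncomputable def mixture {ι : Type*} [Fintype ι] (P : Measure Ω) (Y : ι → Ω → E) : Measure E :=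
  (Fintype.card ι : ℝ≥0∞)⁻¹ • ∑ i, P.map (Y i)

theorem isProbabilityMeasure_mixture {ι : Type*} [Fintype ι] [Nonempty ι] {P : Measure Ω}
    [IsProbabilityMeasure P] {Y : ι → Ω → E} (hY : ∀ i, Measurable (Y i)) :
    IsProbabilityMeasure (mixture P Y) := by
  constructor
  have h (i : ι) : (P.map (Y i)) Set.univ = 1 := by
    rw [Measure.map_apply (hY i) MeasurableSet.univ]
    simp
  simp only [mixture, Measure.smul_apply, Measure.coe_finsetSum, Finset.sum_apply, h,
    Finset.sum_const, Finset.card_univ, nsmul_eq_mul, mul_one, smul_eq_mul]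
  exact ENNReal.inv_mul_cancel (by simp) (by simp)

theorem integral_mixture {ι : Type*} [Fintype ι] {P : Measure Ω}
    [IsProbabilityMeasure P] {Y : ι → Ω → E} (hY : ∀ i, Measurable (Y i)) {φ : E → ℝ}
    (hφ : Measurable φ) {C : ℝ} (hC : ∀ x, |φ x| ≤ C) :
    ∫ x, φ x ∂(mixture P Y) = (Fintype.card ι : ℝ)⁻¹ * ∑ i, ∫ ω, φ (Y i ω) ∂P := by
  have (i : ι) : IsProbabilityMeasure (P.map (Y i)) :=
    Measure.isProbabilityMeasure_map (hY i).aemeasurable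
  unfold mixture
  rw [integral_smul_measure, integral_finsetSum_measure fun i _ =>
    Integrable.of_bound hφ.aestronglyMeasurable C (ae_of_all _ hC)]
  simp only [ENNReal.toReal_inv, ENNReal.toReal_natCast, smul_eq_mul]
  congr 1
  exact Finset.sum_congr rfl fun i _ =>
    integral_map (hY i).aemeasurable hφ.aestronglyMeasurable

end Mixture

section Empirical

variable {Ω : Type*} {mΩ : MeasurableSpace Ω} {P : Measure Ω} [IsProbabilityMeasure P] {N : ℕ}
  {Y : Ω → Fin N → ℝ} {φ ψ : ℝ → ℝ}

theorem integrable_avg (hY : Measurable Y) (hφ : Continuous φ) {C : ℝ} (hC : ∀ x, |φ x| ≤ C) :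
    Integrable (fun ω => avg φ (Y ω)) P :=
  Integrable.of_bound ((continuous_avg hφ).measurable.comp hY).aestronglyMeasurable C
    (ae_of_all _ fun _ => abs_avg_le hC _)

theorem integrable_avg_mul (hY : Measurable Y) (hφ : Continuous φ) {C : ℝ}
    (hC : ∀ x, |φ x| ≤ C) (hψ : Continuous ψ) {D : ℝ} (hD : ∀ x, |ψ x| ≤ D) :
    Integrable (fun ω => avg φ (Y ω) * avg ψ (Y ω)) P :=
  Integrable.of_bound (((continuous_avg hφ).measurable.comp hY).mul
    ((continuous_avg hψ).measurable.comp hY)).aestronglyMeasurable (C * D)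
    (ae_of_all _ fun ω => by
      rw [norm_mul]
      exact mul_le_mul (abs_avg_le hC _) (abs_avg_le hD _) (norm_nonneg _)
        ((abs_nonneg _).trans (hC 0)))

theorem integral_mixture_avg (hY : Measurable Y) (hφ : Continuous φ) {C : ℝ}
    (hC : ∀ x, |φ x| ≤ C) :
    ∫ x, φ x ∂(mixture P fun k ω => Y ω k) = ∫ ω, avg φ (Y ω) ∂P := by
  have hYk (k : Fin N) : Measurable fun ω => Y ω k := (measurable_pi_apply k).comp hY
  rw [integral_mixture hYk hφ.measurable hC]
  unfold avg
  rw [integral_const_mul, integral_finsetSum, Fintype.card_fin]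
  exact fun k _ => Integrable.of_bound (hφ.measurable.comp (hYk k)).aestronglyMeasurable C
    (ae_of_all _ fun _ => hC _)

/-- The mean of the product of the empirical measure with itself. -/
noncomputable def pairMixture (P : Measure Ω) (Y : Ω → Fin N → ℝ) : Measure (WithLp 2 (ℝ × ℝ)) :=
  mixture P fun (p : Fin N × Fin N) ω => WithLp.toLp 2 (Y ω p.1, Y ω p.2)

theorem measurable_pair (hY : Measurable Y) (p : Fin N × Fin N) :
    Measurable fun ω => (WithLp.toLp 2 (Y ω p.1, Y ω p.2) : WithLp 2 (ℝ × ℝ)) :=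
  (WithLp.measurable_toLp 2 _).comp
    (((measurable_pi_apply p.1).comp hY).prodMk ((measurable_pi_apply p.2).comp hY))

/-- The sum over all index pairs, diagonal included, factorises into the two averages, so second
moments of averages become integrals against one measure. Working in `WithLp 2` gives the plane the
inner product used by `charFun`. -/
theorem integral_pairMixture (hY : Measurable Y) (hφ : Continuous φ) {C : ℝ}
    (hC : ∀ x, |φ x| ≤ C) (hψ : Continuous ψ) {D : ℝ} (hD : ∀ x, |ψ x| ≤ D) :
    ∫ x, φ x.fst * ψ x.snd ∂(pairMixture P Y) = ∫ ω, avg φ (Y ω) * avg ψ (Y ω) ∂P := by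
  have hbd (x y : ℝ) : |φ x * ψ y| ≤ C * D := by
    rw [abs_mul]
    exact mul_le_mul (hC _) (hD _) (abs_nonneg _) ((abs_nonneg _).trans (hC 0))
  have hmeas : Measurable fun x : WithLp 2 (ℝ × ℝ) => φ x.fst * ψ x.snd := by
    have := WithLp.measurable_ofLp 2 (ℝ × ℝ)
    exact (hφ.measurable.comp (measurable_fst.comp this)).mul
      (hψ.measurable.comp (measurable_snd.comp this))
  unfold pairMixture
  rw [integral_mixture (measurable_pair hY) hmeas (fun x => hbd _ _), ← integral_finsetSum,
    ← integral_const_mul]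
  · congr 1
    funext ω
    simp only [avg, Fintype.card_prod, Fintype.card_fin, Fintype.sum_prod_type,
      Finset.mul_sum, Finset.sum_mul]
    rw [Finset.sum_comm]
    refine Finset.sum_congr rfl fun k _ => Finset.sum_congr rfl fun l _ => ?_
    change ((N * N : ℕ) : ℝ)⁻¹ * (φ (Y ω l) * ψ (Y ω k)) = _
    push_cast
    rw [mul_inv]
    ring
  · exact fun p _ => Integrable.of_bound
      (hmeas.comp (measurable_pair hY p)).aestronglyMeasurable (C * D)
      (ae_of_all _ fun _ => hbd _ _)

end Empirical

/-! ### Characteristic functions in terms of cosines and sines -/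

theorem charFun_eq_cos_sin (μ : Measure ℝ) [IsFiniteMeasure μ] (ξ : ℝ) :
    charFun μ ξ = (∫ x, Real.cos (ξ * x) ∂μ : ℝ) + (∫ x, Real.sin (ξ * x) ∂μ : ℝ) * Complex.I := by
  have hc : Integrable (fun x => Real.cos (ξ * x)) μ :=
    Integrable.of_bound (by fun_prop) 1 (ae_of_all _ fun x => Real.abs_cos_le_one _)
  have hs : Integrable (fun x => Real.sin (ξ * x)) μ :=
    Integrable.of_bound (by fun_prop) 1 (ae_of_all _ fun x => Real.abs_sin_le_one _)
  rw [charFun_apply_real, ← integral_complex_ofReal, ← integral_complex_ofReal,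
    ← integral_mul_const, ← integral_add hc.ofReal (hs.ofReal.mul_const _)]
  congr 1
  funext x
  push_cast
  rw [Complex.exp_mul_I]

/-- The addition formulas reduce the characteristic function to products of one-variable functions,
the form evaluated by `integral_pairMixture`. -/
theorem charFun_withLp_eq (ν : Measure (WithLp 2 (ℝ × ℝ))) [IsFiniteMeasure ν]
    (w : WithLp 2 (ℝ × ℝ)) :
    charFun ν w =
      ((∫ x, Real.cos (w.fst * x.fst) * Real.cos (w.snd * x.snd) ∂ν
        - ∫ x, Real.sin (w.fst * x.fst) * Real.sin (w.snd * x.snd) ∂ν : ℝ) : ℂ)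
      + ((∫ x, Real.cos (w.fst * x.fst) * Real.sin (w.snd * x.snd) ∂ν
        + ∫ x, Real.sin (w.fst * x.fst) * Real.cos (w.snd * x.snd) ∂ν : ℝ) : ℂ) * Complex.I := by
  have hi (f g : ℝ → ℝ) (hf : Continuous f) (hg : Continuous g) (hf1 : ∀ x, |f x| ≤ 1)
      (hg1 : ∀ x, |g x| ≤ 1) :
      Integrable (fun x : WithLp 2 (ℝ × ℝ) => f (w.fst * x.fst) * g (w.snd * x.snd)) ν := by
    have h1 : Continuous fun x : WithLp 2 (ℝ × ℝ) => f (w.fst * x.fst) * g (w.snd * x.snd) := by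
      have := WithLp.prod_continuous_ofLp 2 ℝ ℝ
      exact (hf.comp (continuous_const.mul (continuous_fst.comp this))).mul
        (hg.comp (continuous_const.mul (continuous_snd.comp this)))
    refine Integrable.of_bound h1.aestronglyMeasurable 1 (ae_of_all _ fun x => ?_)
    rw [norm_mul]
    exact mul_le_one₀ (hf1 _) (norm_nonneg _) (hg1 _)
  have icc := hi _ _ Real.continuous_cos Real.continuous_cos Real.abs_cos_le_one
    Real.abs_cos_le_one
  have iss := hi _ _ Real.continuous_sin Real.continuous_sin Real.abs_sin_le_one
    Real.abs_sin_le_one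
  have ics := hi _ _ Real.continuous_cos Real.continuous_sin Real.abs_cos_le_one
    Real.abs_sin_le_one
  have isc := hi _ _ Real.continuous_sin Real.continuous_cos Real.abs_sin_le_one
    Real.abs_cos_le_one
  rw [charFun_apply, ← integral_sub icc iss, ← integral_add ics isc, ← integral_complex_ofReal,
    ← integral_complex_ofReal, ← integral_mul_const,
    ← integral_add (icc.sub iss).ofReal ((ics.add isc).ofReal.mul_const _)]
  congr 1
  funext x
  rw [WithLp.prod_inner_apply, Complex.exp_mul_I, ← Complex.ofReal_cos, ← Complex.ofReal_sin]
  have e : inner ℝ (WithLp.ofLp x).1 (WithLp.ofLp w).1 + inner ℝ (WithLp.ofLp x).2 (WithLp.ofLp w).2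
      = w.fst * x.fst + w.snd * x.snd := rfl
  rw [e, Real.cos_add, Real.sin_add]
  push_cast
  ring

/-! ### Convergence in probability and convergence of moments -/

section Convergence

variable {Ω : ℕ → Type*} {mΩ : ∀ n, MeasurableSpace (Ω n)} {P : ∀ n, Measure (Ω n)}

/-- The uniform bound turns convergence in probability into convergence in `L¹`: the deviation is
below `ε / 2` off an event of vanishing probability and at most `C + |a|` on it. -/
theorem tendsto_integral_abs_sub [∀ n, IsProbabilityMeasure (P n)] {Y : ∀ n, Ω n → ℝ} {a C : ℝ}
    (hY : ∀ n, Measurable (Y n)) (hC : ∀ n ω, |Y n ω| ≤ C) (h : TendstoInProbability P Y a) :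
    Tendsto (fun n => ∫ ω, |Y n ω - a| ∂(P n)) atTop (𝓝 0) := by
  refine Metric.tendsto_atTop.2 fun ε hε => ?_
  have hD (n : ℕ) (ω : Ω n) : |Y n ω - a| ≤ C + |a| :=
    (abs_sub _ _).trans (add_le_add (hC n ω) le_rfl)
  have hlim : Tendsto (fun n => ε / 2 + (C + |a|) * (P n).real {ω | ε / 2 ≤ |Y n ω - a|}) atTop
      (𝓝 (ε / 2 + (C + |a|) * 0)) := by
    refine ((ENNReal.tendsto_toReal ENNReal.zero_ne_top).comp
      (h (ε / 2) (by positivity))).const_mul _ |>.const_add _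
  rw [mul_zero, add_zero] at hlim
  obtain ⟨n₀, hn₀⟩ := eventually_atTop.1 (hlim.eventually_lt_const (half_lt_self hε))
  refine ⟨n₀, fun n hn => ?_⟩
  rw [Real.dist_eq, sub_zero, abs_of_nonneg (integral_nonneg fun _ => abs_nonneg _)]
  refine lt_of_le_of_lt ?_ (hn₀ n hn)
  have hms : MeasurableSet {ω | ε / 2 ≤ |Y n ω - a|} :=
    measurableSet_le measurable_const ((hY n).sub_const a).abs
  have hi : Integrable (fun ω => |Y n ω - a|) (P n) :=
    Integrable.of_bound ((hY n).sub_const a).abs.aestronglyMeasurable (C + |a|)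
      (ae_of_all _ fun ω => by
        rw [Real.norm_eq_abs, abs_abs]
        exact hD n ω)
  have hind : Integrable (fun ω => {ω | ε / 2 ≤ |Y n ω - a|}.indicator
      (fun _ => C + |a|) ω) (P n) := (integrable_const _).indicator hms
  have hle : ∫ ω, |Y n ω - a| ∂(P n)
      ≤ ∫ ω, (ε / 2 + {ω | ε / 2 ≤ |Y n ω - a|}.indicator (fun _ => C + |a|) ω) ∂(P n) := by
    refine integral_mono hi ((integrable_const _).add hind) fun ω => ?_
    simp only [Set.indicator_apply, Set.mem_ofPred_eq]
    split_ifs with hω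
    · linarith [hD n ω]
    · linarith
  refine hle.trans_eq ?_
  rw [integral_add (integrable_const _) hind, integral_indicator_const _ hms]
  simp [mul_comm]

theorem tendsto_moments [∀ n, IsProbabilityMeasure (P n)] {Y : ∀ n, Ω n → ℝ} {a C : ℝ}
    (hY : ∀ n, Measurable (Y n)) (hC : ∀ n ω, |Y n ω| ≤ C) (h : TendstoInProbability P Y a) :
    Tendsto (fun n => ∫ ω, Y n ω ∂(P n)) atTop (𝓝 a) ∧
      Tendsto (fun n => ∫ ω, Y n ω * Y n ω ∂(P n)
        - (∫ ω, Y n ω ∂(P n)) * ∫ ω, Y n ω ∂(P n)) atTop (𝓝 0) := by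
  have h0 := tendsto_integral_abs_sub hY hC h
  have hi (n : ℕ) : Integrable (Y n) (P n) :=
    Integrable.of_bound (hY n).aestronglyMeasurable C (ae_of_all _ (hC n))
  have hii (n : ℕ) : Integrable (fun ω => Y n ω * Y n ω) (P n) :=
    Integrable.of_bound ((hY n).mul (hY n)).aestronglyMeasurable (C * C) (ae_of_all _ fun ω => by
      rw [norm_mul]
      exact mul_le_mul (hC n ω) (hC n ω) (norm_nonneg _) ((abs_nonneg _).trans (hC n ω)))
  have h1 : Tendsto (fun n => ∫ ω, Y n ω ∂(P n)) atTop (𝓝 a) := by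
    refine tendsto_iff_norm_sub_tendsto_zero.2 (squeeze_zero (fun n => norm_nonneg _)
      (fun n => ?_) h0)
    have : ∫ ω, Y n ω ∂(P n) - a = ∫ ω, (Y n ω - a) ∂(P n) := by
      rw [integral_sub (hi n) (integrable_const _)]
      simp
    rw [this]
    exact norm_integral_le_integral_norm _
  refine ⟨h1, ?_⟩
  have h2 : Tendsto (fun n => ∫ ω, Y n ω * Y n ω ∂(P n)) atTop (𝓝 (a * a)) := by
    have h0' := h0.const_mul (C + |a|)
    rw [mul_zero] at h0'
    refine tendsto_iff_norm_sub_tendsto_zero.2 (squeeze_zero (fun n => norm_nonneg _)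
      (fun n => ?_) h0')
    have : ∫ ω, Y n ω * Y n ω ∂(P n) - a * a = ∫ ω, (Y n ω * Y n ω - a * a) ∂(P n) := by
      rw [integral_sub (hii n) (integrable_const _)]
      simp
    rw [this, ← integral_const_mul]
    refine (norm_integral_le_integral_norm _).trans (integral_mono
      ((hii n).sub (integrable_const _)).norm
      (((hi n).sub (integrable_const _)).abs.const_mul _) fun ω => ?_)
    have e : Y n ω * Y n ω - a * a = (Y n ω + a) * (Y n ω - a) := by ring
    simp only [Real.norm_eq_abs, e, abs_mul]
    exact mul_le_mul_of_nonneg_right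
      ((abs_add_le _ _).trans (add_le_add (hC n ω) le_rfl)) (abs_nonneg _)
  simpa using h2.sub (h1.mul h1)

/-- Chebyshev's inequality: the two limits make the mean of `(Y n - a)²` vanish. -/
theorem tendstoInProbability_of_moments [∀ n, IsProbabilityMeasure (P n)] {Y : ∀ n, Ω n → ℝ}
    {a : ℝ} (hi : ∀ n, Integrable (Y n) (P n))
    (hii : ∀ n, Integrable (fun ω => Y n ω * Y n ω) (P n))
    (h1 : Tendsto (fun n => ∫ ω, Y n ω ∂(P n)) atTop (𝓝 a))
    (h2 : Tendsto (fun n => ∫ ω, Y n ω * Y n ω ∂(P n)) atTop (𝓝 (a * a))) :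
    TendstoInProbability P Y a := by
  have hsq (n : ℕ) : (fun ω => (Y n ω - a) ^ 2)
      = fun ω => Y n ω * Y n ω - 2 * a * Y n ω + a * a := by
    funext ω
    ring
  have i1 (n : ℕ) : Integrable (fun ω => Y n ω * Y n ω - 2 * a * Y n ω) (P n) :=
    (hii n).sub ((hi n).const_mul (2 * a))
  have hint (n : ℕ) : Integrable (fun ω => (Y n ω - a) ^ 2) (P n) := by
    rw [hsq]
    exact (i1 n).add (integrable_const _)
  have hlim : Tendsto (fun n => ∫ ω, (Y n ω - a) ^ 2 ∂(P n)) atTop (𝓝 0) := by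
    have := (h2.sub (h1.const_mul (2 * a))).add_const (a * a)
    rw [show a * a - 2 * a * a + a * a = 0 by ring] at this
    refine this.congr fun n => ?_
    rw [hsq, integral_add (i1 n) (integrable_const _),
      integral_sub (hii n) ((hi n).const_mul _), integral_const_mul]
    simp
  intro ε hε
  have hb : Tendsto (fun n => ENNReal.ofReal ((∫ ω, (Y n ω - a) ^ 2 ∂(P n)) / ε ^ 2)) atTop
      (𝓝 0) := by
    have := ENNReal.tendsto_ofReal (hlim.div_const (ε ^ 2))
    simpa using this
  refine tendsto_of_tendsto_of_tendsto_of_le_of_le tendsto_const_nhds hb (fun n => bot_le)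
    fun n => ?_
  have hm := mul_meas_ge_le_integral_of_nonneg (μ := P n)
    (ae_of_all _ fun ω => sq_nonneg (Y n ω - a)) (hint n) (ε ^ 2)
  have hset : {ω | ε ≤ |Y n ω - a|} = {ω | ε ^ 2 ≤ (Y n ω - a) ^ 2} := by
    ext ω
    simp only [Set.mem_ofPred_eq]
    rw [← sq_abs (Y n ω - a)]
    exact (pow_le_pow_iff_left₀ hε.le (abs_nonneg _) two_ne_zero).symm
  simp only [hset]
  rw [← ENNReal.ofReal_toReal (measure_ne_top (P n) _)]
  refine ENNReal.ofReal_le_ofReal ?_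
  rw [le_div_iff₀ (by positivity), mul_comm]
  exact hm

variable {N : ℕ → ℕ} {Y : ∀ n, Ω n → Fin (N n) → ℝ}

/-- Empirical measures converge weakly in probability as soon as the means of their
characteristic functions converge to a characteristic function and the variances vanish. -/
theorem tendstoWeaklyInProbability_of_trig [∀ n, IsProbabilityMeasure (P n)]
    (hN : ∀ n, 0 < N n) (hY : ∀ n, Measurable (Y n)) (m : ProbabilityMeasure ℝ)
    (hcos : ∀ ξ : ℝ, Tendsto (fun n => ∫ ω, avg (fun y => Real.cos (ξ * y)) (Y n ω) ∂(P n)) atTop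
      (𝓝 (∫ y, Real.cos (ξ * y) ∂(m : Measure ℝ))))
    (hsin : ∀ ξ : ℝ, Tendsto (fun n => ∫ ω, avg (fun y => Real.sin (ξ * y)) (Y n ω) ∂(P n)) atTop
      (𝓝 (∫ y, Real.sin (ξ * y) ∂(m : Measure ℝ))))
    (hvcos : ∀ ξ : ℝ, Tendsto (fun n =>
      ∫ ω, avg (fun y => Real.cos (ξ * y)) (Y n ω) * avg (fun y => Real.cos (ξ * y)) (Y n ω) ∂(P n)
      - (∫ ω, avg (fun y => Real.cos (ξ * y)) (Y n ω) ∂(P n))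
        * ∫ ω, avg (fun y => Real.cos (ξ * y)) (Y n ω) ∂(P n)) atTop (𝓝 0))
    (hvsin : ∀ ξ : ℝ, Tendsto (fun n =>
      ∫ ω, avg (fun y => Real.sin (ξ * y)) (Y n ω) * avg (fun y => Real.sin (ξ * y)) (Y n ω) ∂(P n)
      - (∫ ω, avg (fun y => Real.sin (ξ * y)) (Y n ω) ∂(P n))
        * ∫ ω, avg (fun y => Real.sin (ξ * y)) (Y n ω) ∂(P n)) atTop (𝓝 0)) :
    TendstoWeaklyInProbability P (fun n ω => empiricalMeasure (Y n ω)) m := by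
  have hne (n : ℕ) : Nonempty (Fin (N n)) := ⟨⟨0, hN n⟩⟩
  have hY' (n : ℕ) (k : Fin (N n)) : Measurable fun ω => Y n ω k :=
    (measurable_pi_apply k).comp (hY n)
  have hp1 (n : ℕ) : IsProbabilityMeasure (mixture (P n) fun k ω => Y n ω k) :=
    isProbabilityMeasure_mixture (hY' n)
  have hp2 (n : ℕ) : IsProbabilityMeasure (pairMixture (P n) (Y n)) :=
    isProbabilityMeasure_mixture (measurable_pair (hY n))
  have hcc (ξ : ℝ) : Continuous fun y => Real.cos (ξ * y) := by fun_prop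
  have hsc (ξ : ℝ) : Continuous fun y => Real.sin (ξ * y) := by fun_prop
  have hc1 (ξ : ℝ) : ∀ y, |Real.cos (ξ * y)| ≤ 1 := fun y => Real.abs_cos_le_one _
  have hs1 (ξ : ℝ) : ∀ y, |Real.sin (ξ * y)| ≤ 1 := fun y => Real.abs_sin_le_one _
  -- Vanishing variances force vanishing covariances, hence the mixed second moments factorise in
  -- the limit.
  have hprod (φ ψ : ℝ → ℝ) (hφ : Continuous φ) (hψ : Continuous ψ) (hφ1 : ∀ x, |φ x| ≤ 1)
      (hψ1 : ∀ x, |ψ x| ≤ 1)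
      (h1 : Tendsto (fun n => ∫ ω, avg φ (Y n ω) ∂(P n)) atTop (𝓝 (∫ y, φ y ∂(m : Measure ℝ))))
      (h2 : Tendsto (fun n => ∫ ω, avg ψ (Y n ω) ∂(P n)) atTop (𝓝 (∫ y, ψ y ∂(m : Measure ℝ))))
      (h3 : Tendsto (fun n => ∫ ω, avg φ (Y n ω) * avg φ (Y n ω) ∂(P n)
        - (∫ ω, avg φ (Y n ω) ∂(P n)) * ∫ ω, avg φ (Y n ω) ∂(P n)) atTop (𝓝 0))
      (h4 : Tendsto (fun n => ∫ ω, avg ψ (Y n ω) * avg ψ (Y n ω) ∂(P n)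
        - (∫ ω, avg ψ (Y n ω) ∂(P n)) * ∫ ω, avg ψ (Y n ω) ∂(P n)) atTop (𝓝 0)) :
      Tendsto (fun n => ∫ x, φ x.fst * ψ x.snd ∂(pairMixture (P n) (Y n))) atTop
        (𝓝 ((∫ y, φ y ∂(m : Measure ℝ)) * ∫ y, ψ y ∂(m : Measure ℝ))) := by
    have hcov : Tendsto (fun n => ∫ ω, avg φ (Y n ω) * avg ψ (Y n ω) ∂(P n)
        - (∫ ω, avg φ (Y n ω) ∂(P n)) * ∫ ω, avg ψ (Y n ω) ∂(P n)) atTop (𝓝 0) := by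
      refine squeeze_zero_norm (fun n => ?_) (by simpa using h3.add h4)
      exact abs_cov_le (integrable_avg (hY n) hφ hφ1) (integrable_avg (hY n) hψ hψ1)
        (integrable_avg_mul (hY n) hφ hφ1 hφ hφ1) (integrable_avg_mul (hY n) hψ hψ1 hψ hψ1)
        (integrable_avg_mul (hY n) hφ hφ1 hψ hψ1)
    have := hcov.add (h1.mul h2)
    rw [zero_add] at this
    refine this.congr fun n => ?_
    rw [integral_pairMixture (hY n) hφ hφ1 hψ hψ1]
    ring
  set μ : ℕ → ProbabilityMeasure ℝ := fun n => ⟨mixture (P n) fun k ω => Y n ω k, hp1 n⟩ with hμ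
  set ν : ℕ → ProbabilityMeasure (WithLp 2 (ℝ × ℝ)) := fun n => ⟨pairMixture (P n) (Y n), hp2 n⟩
    with hν
  have hmm : IsProbabilityMeasure (((m : Measure ℝ).prod (m : Measure ℝ)).map (WithLp.toLp 2)) :=
    Measure.isProbabilityMeasure_map (WithLp.measurable_toLp 2 _).aemeasurable
  set mm : ProbabilityMeasure (WithLp 2 (ℝ × ℝ)) :=
    ⟨((m : Measure ℝ).prod (m : Measure ℝ)).map (WithLp.toLp 2), hmm⟩ with hmmdef
  have hμlim : Tendsto μ atTop (𝓝 m) := by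
    refine ProbabilityMeasure.tendsto_of_tendsto_charFun fun ξ => ?_
    rw [charFun_eq_cos_sin]
    have h1 := (Complex.continuous_ofReal.tendsto _).comp (hcos ξ)
    have h2 := ((Complex.continuous_ofReal.tendsto _).comp (hsin ξ)).mul_const Complex.I
    refine (h1.add h2).congr fun n => ?_
    rw [charFun_eq_cos_sin]
    simp only [hμ, Function.comp_apply, ProbabilityMeasure.coe_mk]
    rw [integral_mixture_avg (hY n) (hcc ξ) (hc1 ξ), integral_mixture_avg (hY n) (hsc ξ) (hs1 ξ)]
  -- The mean product measure converges to `m ⊗ m`: asymptotically the empirical measure is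
  -- deterministic.
  have hνlim : Tendsto ν atTop (𝓝 mm) := by
    refine ProbabilityMeasure.tendsto_of_tendsto_charFun fun w => ?_
    have hcl : charFun (mm : Measure (WithLp 2 (ℝ × ℝ))) w
        = charFun (m : Measure ℝ) w.fst * charFun (m : Measure ℝ) w.snd := charFun_prod w
    have k1 := hprod _ _ (hcc w.fst) (hcc w.snd) (hc1 _) (hc1 _) (hcos _) (hcos _) (hvcos _)
      (hvcos _)
    have k2 := hprod _ _ (hsc w.fst) (hsc w.snd) (hs1 _) (hs1 _) (hsin _) (hsin _) (hvsin _)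
      (hvsin _)
    have k3 := hprod _ _ (hcc w.fst) (hsc w.snd) (hc1 _) (hs1 _) (hcos _) (hsin _) (hvcos _)
      (hvsin _)
    have k4 := hprod _ _ (hsc w.fst) (hcc w.snd) (hs1 _) (hc1 _) (hsin _) (hcos _) (hvsin _)
      (hvcos _)
    have h1 := (Complex.continuous_ofReal.tendsto _).comp (k1.sub k2)
    have h2 := ((Complex.continuous_ofReal.tendsto _).comp (k3.add k4)).mul_const Complex.I
    have h3 := h1.add h2
    rw [hcl, charFun_eq_cos_sin, charFun_eq_cos_sin]
    convert h3 using 1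
    · funext n
      exact charFun_withLp_eq (pairMixture (P n) (Y n)) w
    · congr 1
      push_cast
      linear_combination (Complex.ofReal (∫ y, Real.sin (w.fst * y) ∂(m : Measure ℝ)))
        * (Complex.ofReal (∫ y, Real.sin (w.snd * y) ∂(m : Measure ℝ))) * Complex.I_sq
  intro φ
  have hφb : ∀ x, |φ x| ≤ ‖φ‖ := φ.norm_coe_le_norm
  simp only [integral_empiricalMeasure]
  refine tendstoInProbability_of_moments (fun n => integrable_avg (hY n) φ.continuous hφb)
    (fun n => integrable_avg_mul (hY n) φ.continuous hφb φ.continuous hφb) ?_ ?_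
  · refine ((ProbabilityMeasure.tendsto_iff_forall_integral_tendsto.1 hμlim) φ).congr fun n => ?_
    exact integral_mixture_avg (hY n) φ.continuous hφb
  · have hcont : Continuous fun x : WithLp 2 (ℝ × ℝ) => φ x.fst * φ x.snd := by
      have := WithLp.prod_continuous_ofLp 2 ℝ ℝ
      exact (φ.continuous.comp (continuous_fst.comp this)).mul
        (φ.continuous.comp (continuous_snd.comp this))
    set Φ : WithLp 2 (ℝ × ℝ) →ᵇ ℝ := BoundedContinuousFunction.ofNormedAddCommGroup
      (fun x : WithLp 2 (ℝ × ℝ) => φ x.fst * φ x.snd) hcont (‖φ‖ * ‖φ‖) (fun x => by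
        rw [norm_mul]
        exact mul_le_mul (hφb _) (hφb _) (norm_nonneg _) (norm_nonneg _)) with hΦ
    have hl := (ProbabilityMeasure.tendsto_iff_forall_integral_tendsto.1 hνlim) Φ
    have he : ∫ x, Φ x ∂(mm : Measure (WithLp 2 (ℝ × ℝ)))
        = (∫ x, φ x ∂(m : Measure ℝ)) * ∫ x, φ x ∂(m : Measure ℝ) := by
      rw [← integral_prod_mul]
      exact integral_map (WithLp.measurable_toLp 2 _).aemeasurable
        hcont.aestronglyMeasurable
    rw [he] at hl
    refine hl.congr fun n => ?_
    exact integral_pairMixture (hY n) φ.continuous hφb φ.continuous hφb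

end Convergence

/-! ### Schwartz test functions and the weak equation -/

theorem schwartz_isBddC1 (φ : 𝓢(ℝ, ℝ)) : IsBddC1 φ where
  contDiff := φ.smooth 1
  bdd := by
    obtain ⟨C, hC⟩ := φ.decay 0 0
    exact ⟨C, fun x => by simpa using hC.2 x⟩
  bdd_deriv := by
    obtain ⟨C, hC⟩ := φ.decay 0 1
    refine ⟨C, fun x => ?_⟩
    have := hC.2 x
    rwa [pow_zero, one_mul, norm_iteratedFDeriv_eq_norm_iteratedDeriv, iteratedDeriv_one] at this

theorem IsBddC1.continuous_deriv {φ : ℝ → ℝ} (h : IsBddC1 φ) : Continuous (deriv φ) :=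
  h.contDiff.continuous_deriv le_rfl

theorem IsBddC1.integrable {φ : ℝ → ℝ} (h : IsBddC1 φ) (m : Measure ℝ) [IsFiniteMeasure m] :
    Integrable φ m := by
  obtain ⟨C, hC⟩ := h.bdd
  exact Integrable.of_bound h.contDiff.continuous.aestronglyMeasurable C (ae_of_all _ hC)

theorem IsBddC1.integrable_deriv {φ : ℝ → ℝ} (h : IsBddC1 φ) (m : Measure ℝ) [IsFiniteMeasure m] :
    Integrable (deriv φ) m := by
  obtain ⟨C, hC⟩ := h.bdd_deriv
  exact Integrable.of_bound h.continuous_deriv.aestronglyMeasurable C (ae_of_all _ hC)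

/-- Regrouping by test function instead of by measure separates the two equations and matches
`generator_avg₁` and `generator_avg₂`. -/
theorem weakRHS_eq (v₁ v₂ α₁₂ α₂₁ : ℝ) (φ₁ φ₂ : 𝓢(ℝ, ℝ)) (μ₁ μ₂ : Measure ℝ)
    [IsFiniteMeasure μ₁] [IsFiniteMeasure μ₂] :
    weakRHS v₁ v₂ α₁₂ α₂₁ φ₁ φ₂ μ₁ μ₂
      = (v₁ * ∫ x, deriv φ₁ x ∂μ₁ + α₁₂ * (∫ x, φ₁ x ∂μ₂ - ∫ x, φ₁ x ∂μ₁))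
        + (v₂ * ∫ x, deriv φ₂ x ∂μ₂ + α₂₁ * (∫ x, φ₂ x ∂μ₁ - ∫ x, φ₂ x ∂μ₂)) := by
  have h₁ := schwartz_isBddC1 φ₁
  have h₂ := schwartz_isBddC1 φ₂
  have i₁ : Integrable (fun x => v₁ * deriv φ₁ x - α₁₂ * φ₁ x) μ₁ :=
    ((h₁.integrable_deriv μ₁).const_mul _).sub ((h₁.integrable μ₁).const_mul _)
  have i₂ : Integrable (fun x => v₂ * deriv φ₂ x + α₁₂ * φ₁ x) μ₂ :=
    ((h₂.integrable_deriv μ₂).const_mul _).add ((h₁.integrable μ₂).const_mul _)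
  unfold weakRHS
  rw [integral_add i₁ ((h₂.integrable μ₁).const_mul _),
    integral_sub ((h₁.integrable_deriv μ₁).const_mul _) ((h₁.integrable μ₁).const_mul _),
    integral_sub i₂ ((h₂.integrable μ₂).const_mul _),
    integral_add ((h₂.integrable_deriv μ₂).const_mul _) ((h₁.integrable μ₂).const_mul _)]
  simp only [integral_const_mul]
  ring

/-- Dominated convergence; the limit inherits measurability and the bound, so the interval
integrability required in the weak formulation needs no regularity of the limit in time. -/
theorem intervalIntegral_tendsto_of_bounded {F : ℕ → ℝ → ℝ} {f : ℝ → ℝ} {C : ℝ}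
    (hF : ∀ n, Measurable (F n)) (hC : ∀ n s, |F n s| ≤ C)
    (hlim : ∀ s, Tendsto (fun n => F n s) atTop (𝓝 (f s))) (a b : ℝ) :
    IntervalIntegrable f volume a b ∧
      Tendsto (fun n => ∫ s in a..b, F n s) atTop (𝓝 (∫ s in a..b, f s)) := by
  have hf : Measurable f := measurable_of_tendsto_metrizable hF (tendsto_pi_nhds.2 hlim)
  refine ⟨(intervalIntegrable_const (c := C)).mono_fun hf.aestronglyMeasurable
    (ae_of_all _ fun s => ?_), ?_⟩
  · exact (le_of_tendsto (hlim s).abs (Eventually.of_forall fun n => hC n s)).trans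
      (le_abs_self C)
  · exact intervalIntegral.tendsto_integral_filter_of_dominated_convergence (fun _ => C)
      (Eventually.of_forall fun n => (hF n).aestronglyMeasurable)
      (Eventually.of_forall fun n => ae_of_all _ fun s _ => hC n s)
      intervalIntegrable_const (ae_of_all _ fun s _ => hlim s)

theorem forall_fin_four {p : Fin 4 → Prop} (h0 : p 0) (h1 : p 1) (h2 : p 2) (h3 : p 3) (k : Fin 4) :
    p k := by
  fin_cases k <;> assumption

/-! ### Passage to the limit -/

section Limit

variable {v₁ v₂ α₁₂ α₂₁ : ℝ} {N₁ N₂ : ℕ → ℕ} {Ω : ℕ → Type*} {mΩ : ∀ n, MeasurableSpace (Ω n)}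
  {P : ∀ n, Measure (Ω n)} [∀ n, IsProbabilityMeasure (P n)] {𝓕 : ∀ n, Filtration ℝ≥0 (mΩ n)}
  {X : ∀ n, ℝ≥0 → Ω n → Config (N₁ n) (N₂ n)}

/-- The mean equation passes to the limit. -/
theorem limit_equation {g G : ∀ n, Config (N₁ n) (N₂ n) → ℝ}
    (hX : ∀ n, IsParticleSystem v₁ v₂ α₁₂ α₂₁ (P n) (𝓕 n) (X n))
    (hg : ∀ n, IsTestFunction (g n)) (hG : ∀ n x, generator v₁ v₂ α₁₂ α₂₁ (g n) x = G n x)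
    {C : ℝ} (hC : ∀ n x, |G n x| ≤ C) {u h : ℝ≥0 → ℝ}
    (hu : ∀ t, Tendsto (fun n => ∫ ω, g n (X n t ω) ∂(P n)) atTop (𝓝 (u t)))
    (hh : ∀ t, Tendsto (fun n => ∫ ω, G n (X n t ω) ∂(P n)) atTop (𝓝 (h t))) (t : ℝ≥0) :
    IntervalIntegrable (fun s : ℝ => h s.toNNReal) volume 0 t ∧
      u t = u 0 + ∫ s in (0 : ℝ)..t, h s.toNNReal := by
  have hGg (n : ℕ) : generator v₁ v₂ α₁₂ α₂₁ (g n) = G n := funext (hG n)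
  have hGc (n : ℕ) : Continuous (G n) := hGg n ▸ (hg n).continuous_generator v₁ v₂ α₁₂ α₂₁
  obtain ⟨h1, h2⟩ := intervalIntegral_tendsto_of_bounded
    (F := fun n s => ∫ ω, G n (X n s.toNNReal ω) ∂(P n)) (f := fun s => h s.toNNReal) (C := C)
    (fun n => (hX n).measurable_integral_comp (hGc n))
    (fun n s => IsParticleSystem.abs_integral_comp_le (hC n) _) (fun s => hh _) 0 t
  refine ⟨h1, tendsto_nhds_unique (hu t) (((hu 0).add h2).congr fun n => ?_)⟩
  rw [(hX n).integral_eq (hg n) t, hGg n]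

/-- Weak convergence in probability of bounded statistics gives convergence of their means. The
generator of an average is linear in averages, so Dynkin's formula passes to the limit without a
factorisation of moments. -/
theorem isWeakSolution_of_tendsto (hN₁ : ∀ n, 0 < N₁ n) (hN₂ : ∀ n, 0 < N₂ n)
    (hX : ∀ n, IsParticleSystem v₁ v₂ α₁₂ α₂₁ (P n) (𝓕 n) (X n))
    {m₁ m₂ : ℝ≥0 → ProbabilityMeasure ℝ}
    (h₁ : ∀ t, TendstoWeaklyInProbability P (fun n ω => empiricalMeasure (X n t ω).1) (m₁ t))
    (h₂ : ∀ t, TendstoWeaklyInProbability P (fun n ω => empiricalMeasure (X n t ω).2) (m₂ t)) :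
    IsWeakSolution v₁ v₂ α₁₂ α₂₁ m₁ m₂ := by
  have l₁ (φ : ℝ → ℝ) (hφ : Continuous φ) (hb : ∃ C, ∀ x, |φ x| ≤ C) (t : ℝ≥0) :
      Tendsto (fun n => ∫ ω, avg φ (X n t ω).1 ∂(P n)) atTop
        (𝓝 (∫ x, φ x ∂(m₁ t : Measure ℝ))) := by
    obtain ⟨C, hC⟩ := hb
    have := h₁ t (BoundedContinuousFunction.ofNormedAddCommGroup φ hφ C hC)
    simp only [integral_empiricalMeasure] at this
    exact (tendsto_moments (fun n => ((continuous_avg hφ).measurable.comp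
      (measurable_fst.comp ((hX n).measurable t)))) (fun n ω => abs_avg_le hC _) this).1
  have l₂ (φ : ℝ → ℝ) (hφ : Continuous φ) (hb : ∃ C, ∀ x, |φ x| ≤ C) (t : ℝ≥0) :
      Tendsto (fun n => ∫ ω, avg φ (X n t ω).2 ∂(P n)) atTop
        (𝓝 (∫ x, φ x ∂(m₂ t : Measure ℝ))) := by
    obtain ⟨C, hC⟩ := hb
    have := h₂ t (BoundedContinuousFunction.ofNormedAddCommGroup φ hφ C hC)
    simp only [integral_empiricalMeasure] at this
    exact (tendsto_moments (fun n => ((continuous_avg hφ).measurable.comp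
      (measurable_snd.comp ((hX n).measurable t)))) (fun n ω => abs_avg_le hC _) this).1
  have i₁ (φ : ℝ → ℝ) (hφ : Continuous φ) (hb : ∃ C, ∀ x, |φ x| ≤ C) (n : ℕ) (t : ℝ≥0) :
      Integrable (fun ω => avg φ (X n t ω).1) (P n) := by
    obtain ⟨C, hC⟩ := hb
    exact integrable_avg (measurable_fst.comp ((hX n).measurable t)) hφ hC
  have i₂ (φ : ℝ → ℝ) (hφ : Continuous φ) (hb : ∃ C, ∀ x, |φ x| ≤ C) (n : ℕ) (t : ℝ≥0) :
      Integrable (fun ω => avg φ (X n t ω).2) (P n) := by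
    obtain ⟨C, hC⟩ := hb
    exact integrable_avg (measurable_snd.comp ((hX n).measurable t)) hφ hC
  have bound (v α a b c A B : ℝ) (ha : |a| ≤ B) (hb : |b| ≤ A) (hc : |c| ≤ A) :
      |v * a + α * (b - c)| ≤ |v| * B + |α| * (A + A) := by
    refine (abs_add_le _ _).trans (add_le_add ?_ ?_)
    · rw [abs_mul]
      exact mul_le_mul_of_nonneg_left ha (abs_nonneg _)
    · rw [abs_mul]
      exact mul_le_mul_of_nonneg_left ((abs_sub _ _).trans (add_le_add hb hc)) (abs_nonneg _)
  intro φ₁ φ₂ t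
  have b₁ := schwartz_isBddC1 φ₁
  have b₂ := schwartz_isBddC1 φ₂
  have c₁ := b₁.contDiff.continuous
  have c₂ := b₂.contDiff.continuous
  obtain ⟨A₁, hA₁⟩ := b₁.bdd
  obtain ⟨B₁, hB₁⟩ := b₁.bdd_deriv
  obtain ⟨A₂, hA₂⟩ := b₂.bdd
  obtain ⟨B₂, hB₂⟩ := b₂.bdd_deriv
  obtain ⟨j₁, e₁⟩ := limit_equation (g := fun n x => avg φ₁ x.1) hX
    (fun n => isTestFunction_avg₁ b₁)
    (fun n x => generator_avg₁ v₁ v₂ α₁₂ α₂₁ (hN₁ n) (hN₂ n) b₁ x)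
    (fun n x => bound v₁ α₁₂ _ _ _ A₁ B₁ (abs_avg_le hB₁ _) (abs_avg_le hA₁ _)
      (abs_avg_le hA₁ _)) (l₁ φ₁ c₁ b₁.bdd)
    (h := fun s => v₁ * ∫ x, deriv φ₁ x ∂(m₁ s : Measure ℝ)
      + α₁₂ * (∫ x, φ₁ x ∂(m₂ s : Measure ℝ) - ∫ x, φ₁ x ∂(m₁ s : Measure ℝ)))
    (fun s => by
      refine (((l₁ _ b₁.continuous_deriv b₁.bdd_deriv s).const_mul v₁).add
        (((l₂ _ c₁ b₁.bdd s).sub (l₁ _ c₁ b₁.bdd s)).const_mul α₁₂)).congr fun n => ?_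
      rw [← integral_sub (i₂ _ c₁ b₁.bdd n s) (i₁ _ c₁ b₁.bdd n s), ← integral_const_mul,
        ← integral_const_mul]
      exact (integral_add ((i₁ _ b₁.continuous_deriv b₁.bdd_deriv n s).const_mul _)
        (((i₂ _ c₁ b₁.bdd n s).sub (i₁ _ c₁ b₁.bdd n s)).const_mul _)).symm) t
  obtain ⟨j₂, e₂⟩ := limit_equation (g := fun n x => avg φ₂ x.2) hX
    (fun n => isTestFunction_avg₂ b₂)
    (fun n x => generator_avg₂ v₁ v₂ α₁₂ α₂₁ (hN₁ n) (hN₂ n) b₂ x)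
    (fun n x => bound v₂ α₂₁ _ _ _ A₂ B₂ (abs_avg_le hB₂ _) (abs_avg_le hA₂ _)
      (abs_avg_le hA₂ _)) (l₂ φ₂ c₂ b₂.bdd)
    (h := fun s => v₂ * ∫ x, deriv φ₂ x ∂(m₂ s : Measure ℝ)
      + α₂₁ * (∫ x, φ₂ x ∂(m₁ s : Measure ℝ) - ∫ x, φ₂ x ∂(m₂ s : Measure ℝ)))
    (fun s => by
      refine (((l₂ _ b₂.continuous_deriv b₂.bdd_deriv s).const_mul v₂).add
        (((l₁ _ c₂ b₂.bdd s).sub (l₂ _ c₂ b₂.bdd s)).const_mul α₂₁)).congr fun n => ?_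
      rw [← integral_sub (i₁ _ c₂ b₂.bdd n s) (i₂ _ c₂ b₂.bdd n s), ← integral_const_mul,
        ← integral_const_mul]
      exact (integral_add ((i₂ _ b₂.continuous_deriv b₂.bdd_deriv n s).const_mul _)
        (((i₁ _ c₂ b₂.bdd n s).sub (i₂ _ c₂ b₂.bdd n s)).const_mul _)).symm) t
  simp only [weakRHS_eq]
  refine ⟨j₁.add j₂, ?_⟩
  rw [intervalIntegral.integral_add j₁ j₂, e₁, e₂]
  ring

/-- The means for all `n` solve one and the same linear system, so their mutual distances at time
`t` are controlled by those at time `0`, and the Cauchy property propagates. -/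
theorem exists_tendsto_trigMean (hN₁ : ∀ n, 0 < N₁ n) (hN₂ : ∀ n, 0 < N₂ n)
    (hX : ∀ n, IsParticleSystem v₁ v₂ α₁₂ α₂₁ (P n) (𝓕 n) (X n)) {ξ : ℝ}
    (h0 : ∀ k, ∃ a, Tendsto (fun n => trigMean (P n) (X n) ξ k 0) atTop (𝓝 a)) {t : ℝ}
    (ht : 0 ≤ t) (k : Fin 4) :
    ∃ a, Tendsto (fun n => trigMean (P n) (X n) ξ k t) atTop (𝓝 a) := by
  choose a ha using h0
  set E := Real.exp (4 * freqBound v₁ v₂ α₁₂ α₂₁ ξ * t) with hE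
  have hbound (p q : ℕ) : |trigMean (P p) (X p) ξ k t - trigMean (P q) (X q) ξ k t|
      ≤ (∑ k, |trigMean (P p) (X p) ξ k 0 - trigMean (P q) (X q) ξ k 0|) * E :=
    (Finset.single_le_sum (f := fun k => |trigMean (P p) (X p) ξ k t - trigMean (P q) (X q) ξ k t|)
      (fun _ _ => abs_nonneg _) (Finset.mem_univ k)).trans
      (((hX p).isFreqSolution (hN₁ p) (hN₂ p) ξ).sum_abs_sub_le
        ((hX q).isFreqSolution (hN₁ q) (hN₂ q) ξ) ht)
  refine cauchySeq_tendsto_of_complete (cauchySeq_iff_tendsto_dist_atTop_0.2 ?_)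
  refine squeeze_zero (fun _ => dist_nonneg) (fun p => hbound p.1 p.2) ?_
  have hlim : Tendsto (fun p : ℕ × ℕ =>
      (∑ k, |trigMean (P p.1) (X p.1) ξ k 0 - trigMean (P p.2) (X p.2) ξ k 0|) * E) atTop
      (𝓝 ((∑ k, |a k - a k|) * E)) := by
    rw [← prod_atTop_atTop_eq]
    refine Tendsto.mul_const _ (tendsto_finsetSum _ fun k _ => ?_)
    exact (((ha k).comp tendsto_fst).sub ((ha k).comp tendsto_snd)).abs
  simpa using hlim

theorem tendsto_trigVar (hN₁ : Tendsto N₁ atTop atTop) (hN₂ : Tendsto N₂ atTop atTop)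
    (hN₁' : ∀ n, 0 < N₁ n) (hN₂' : ∀ n, 0 < N₂ n) (hα₁₂ : 0 ≤ α₁₂) (hα₂₁ : 0 ≤ α₂₁)
    (hX : ∀ n, IsParticleSystem v₁ v₂ α₁₂ α₂₁ (P n) (𝓕 n) (X n)) {ξ : ℝ}
    (h0 : ∀ k, Tendsto (fun n => trigVar (P n) (X n) ξ k 0) atTop (𝓝 0)) {t : ℝ}
    (ht : 0 ≤ t) (k : Fin 4) :
    Tendsto (fun n => trigVar (P n) (X n) ξ k t) atTop (𝓝 0) := by
  refine squeeze_zero (fun n => (hX n).trigVar_nonneg ξ k t) (fun n =>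
    (Finset.single_le_sum (f := fun k => trigVar (P n) (X n) ξ k t)
      (fun k _ => (hX n).trigVar_nonneg ξ k t) (Finset.mem_univ k)).trans
      ((hX n).sum_trigVar_le (hN₁' n) (hN₂' n) hα₁₂ hα₂₁ ξ ht)) ?_
  have l₁ : Tendsto (fun n => ((N₁ n : ℝ))⁻¹) atTop (𝓝 0) :=
    tendsto_inv_atTop_zero.comp (tendsto_natCast_atTop_atTop.comp hN₁)
  have l₂ : Tendsto (fun n => ((N₂ n : ℝ))⁻¹) atTop (𝓝 0) :=
    tendsto_inv_atTop_zero.comp (tendsto_natCast_atTop_atTop.comp hN₂)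
  have := (((tendsto_finsetSum Finset.univ fun k _ => h0 k).add
    ((((l₁.const_mul (4 * α₁₂)).add (l₂.const_mul (4 * α₂₁))).const_mul 4).mul_const t)).mul_const
    (Real.exp (4 * (10 * freqBound v₁ v₂ α₁₂ α₂₁ ξ) * t)))
  simpa using this

/-- The bound of `sum_abs_sub_one_le` is uniform in `n` and survives the limit `n → ∞`; only then
does `ξ → 0`. Thus continuity at frequency `0` propagates in time, and no separate tightness
argument is needed at time `t`. -/
theorem tendsto_limit_trigMean_zero (hN₁ : ∀ n, 0 < N₁ n) (hN₂ : ∀ n, 0 < N₂ n)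
    (hX : ∀ n, IsParticleSystem v₁ v₂ α₁₂ α₂₁ (P n) (𝓕 n) (X n)) {z₀ z : ℝ → Fin 4 → ℝ} {t : ℝ}
    (ht : 0 ≤ t)
    (h0 : ∀ ξ k, Tendsto (fun n => trigMean (P n) (X n) ξ k 0) atTop (𝓝 (z₀ ξ k)))
    (h : ∀ ξ k, Tendsto (fun n => trigMean (P n) (X n) ξ k t) atTop (𝓝 (z ξ k)))
    (hc : ∀ k, Tendsto (fun ξ => z₀ ξ k) (𝓝 0) (𝓝 (![1, 0, 1, 0] k))) (k : Fin 4) :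
    Tendsto (fun ξ => z ξ k) (𝓝 0) (𝓝 (![1, 0, 1, 0] k)) := by
  have hle (ξ : ℝ) : ‖z ξ k - ![1, 0, 1, 0] k‖
      ≤ (∑ k, |z₀ ξ k - ![1, 0, 1, 0] k| + 4 * ((|v₁| + |v₂|) * |ξ|) * t)
        * Real.exp (4 * freqBound v₁ v₂ α₁₂ α₂₁ ξ * t) := by
    refine (Finset.single_le_sum (f := fun k => |z ξ k - ![1, 0, 1, 0] k|)
      (fun _ _ => abs_nonneg _) (Finset.mem_univ k)).trans ?_
    refine le_of_tendsto_of_tendsto'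
      (tendsto_finsetSum Finset.univ fun k _ => ((h ξ k).sub_const (![1, 0, 1, 0] k)).abs)
      (((tendsto_finsetSum Finset.univ fun k _ =>
        ((h0 ξ k).sub_const (![1, 0, 1, 0] k)).abs).add_const _).mul_const _) fun n => ?_
    exact ((hX n).isFreqSolution (hN₁ n) (hN₂ n) ξ).sum_abs_sub_one_le ht
  refine tendsto_iff_norm_sub_tendsto_zero.2 (squeeze_zero (fun _ => norm_nonneg _) hle ?_)
  have l1 : Tendsto (fun ξ => ∑ k, |z₀ ξ k - ![1, 0, 1, 0] k|) (𝓝 0) (𝓝 0) := by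
    have := tendsto_finsetSum Finset.univ fun k _ => ((hc k).sub_const (![1, 0, 1, 0] k)).abs
    simpa only [sub_self, abs_zero, Finset.sum_const_zero] using this
  have l2 : Continuous fun ξ : ℝ => 4 * ((|v₁| + |v₂|) * |ξ|) * t := by fun_prop
  have l3 : Continuous fun ξ : ℝ => Real.exp (4 * freqBound v₁ v₂ α₁₂ α₂₁ ξ * t) := by
    unfold freqBound
    fun_prop
  have := (l1.add (l2.tendsto 0)).mul (l3.tendsto 0)
  simpa using this

theorem ofReal_add_mul_I_tendsto {ι : Type*} {l : Filter ι} {f g : ι → ℝ} {a b : ℝ}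
    (hf : Tendsto f l (𝓝 a)) (hg : Tendsto g l (𝓝 b)) :
    Tendsto (fun i => (f i : ℂ) + g i * Complex.I) l (𝓝 (a + b * Complex.I)) :=
  ((Complex.continuous_ofReal.tendsto _).comp hf).add
    (((Complex.continuous_ofReal.tendsto _).comp hg).mul_const _)

/-- Convergence of the means of the trigonometric observables of a random point configuration,
with a limit continuous at frequency `0`, yields a limiting probability measure. -/
theorem exists_probabilityMeasure_of_trig {N : ℕ → ℕ} {Y : ∀ n, Ω n → Fin (N n) → ℝ}
    (hN : ∀ n, 0 < N n) (hY : ∀ n, Measurable (Y n)) {c s : ℝ → ℝ}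
    (hcos : ∀ ξ : ℝ, Tendsto (fun n => ∫ ω, avg (fun y => Real.cos (ξ * y)) (Y n ω) ∂(P n)) atTop
      (𝓝 (c ξ)))
    (hsin : ∀ ξ : ℝ, Tendsto (fun n => ∫ ω, avg (fun y => Real.sin (ξ * y)) (Y n ω) ∂(P n)) atTop
      (𝓝 (s ξ)))
    (hc : Tendsto c (𝓝 0) (𝓝 1)) (hs : Tendsto s (𝓝 0) (𝓝 0)) :
    ∃ m : ProbabilityMeasure ℝ, ∀ ξ : ℝ, ∫ x, Real.cos (ξ * x) ∂(m : Measure ℝ) = c ξ ∧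
      ∫ x, Real.sin (ξ * x) ∂(m : Measure ℝ) = s ξ := by
  have hne (n : ℕ) : Nonempty (Fin (N n)) := ⟨⟨0, hN n⟩⟩
  have hp (n : ℕ) : IsProbabilityMeasure (mixture (P n) fun k ω => Y n ω k) :=
    isProbabilityMeasure_mixture fun k => (measurable_pi_apply k).comp (hY n)
  set f : ℝ → ℂ := fun ξ => (c ξ : ℂ) + s ξ * Complex.I with hf
  -- The full neighbourhood filter contains the point itself, so the limit determines the value at
  -- `0`.
  have hc0 : c 0 = 1 := (tendsto_nhds_unique (tendsto_pure_nhds c 0) (hc.mono_left (pure_le_nhds 0)))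
  have hs0 : s 0 = 0 := (tendsto_nhds_unique (tendsto_pure_nhds s 0) (hs.mono_left (pure_le_nhds 0)))
  have hfc : ContinuousAt f 0 := by
    have h0 : f 0 = ((1 : ℝ) : ℂ) + ((0 : ℝ) : ℂ) * Complex.I := by simp only [hf, hc0, hs0]
    unfold ContinuousAt
    rw [h0]
    exact ofReal_add_mul_I_tendsto hc hs
  obtain ⟨m, -, hm⟩ := exists_tendsto_of_tendsto_charFun
    (μ := fun n => ⟨mixture (P n) fun k ω => Y n ω k, hp n⟩) hfc fun ξ => by
      refine (ofReal_add_mul_I_tendsto (hcos ξ) (hsin ξ)).congr fun n => ?_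
      simp only [ProbabilityMeasure.coe_mk]
      rw [charFun_eq_cos_sin, integral_mixture_avg (hY n) (by fun_prop)
        (fun y => Real.abs_cos_le_one (ξ * y)), integral_mixture_avg (hY n) (by fun_prop)
        (fun y => Real.abs_sin_le_one (ξ * y))]
  refine ⟨m, fun ξ => ?_⟩
  have := hm ξ
  rw [charFun_eq_cos_sin] at this
  have hre := congrArg Complex.re this
  have him := congrArg Complex.im this
  simp only [hf, Complex.add_re, Complex.ofReal_re, Complex.re_ofReal_mul, Complex.I_re, mul_zero,
    add_zero, Complex.add_im, Complex.ofReal_im, Complex.im_ofReal_mul, Complex.I_im, mul_one,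
    zero_add] at hre him
  exact ⟨hre, him⟩

/-- Convergence in probability of all bounded `C¹` statistics forces the limits of the
trigonometric ones to be continuous at frequency `0`. -/
theorem tendsto_trig_zero {N : ℕ → ℕ} {Y : ∀ n, Ω n → Fin (N n) → ℝ}
    (hN : ∀ n, 0 < N n) (hY : ∀ n, Measurable (Y n))
    (hinit : ∀ φ : ℝ → ℝ, ContDiff ℝ 1 φ → (∃ C : ℝ, ∀ x, |φ x| ≤ C) →
      ∃ a : ℝ, TendstoInProbability P (fun n ω => ∫ x, φ x ∂(empiricalMeasure (Y n ω))) a)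
    {c s : ℝ → ℝ}
    (hcos : ∀ ξ : ℝ, Tendsto (fun n => ∫ ω, avg (fun y => Real.cos (ξ * y)) (Y n ω) ∂(P n)) atTop
      (𝓝 (c ξ)))
    (hsin : ∀ ξ : ℝ, Tendsto (fun n => ∫ ω, avg (fun y => Real.sin (ξ * y)) (Y n ω) ∂(P n)) atTop
      (𝓝 (s ξ))) :
    Tendsto c (𝓝 0) (𝓝 1) ∧ Tendsto s (𝓝 0) (𝓝 0) := by
  have hne (n : ℕ) : Nonempty (Fin (N n)) := ⟨⟨0, hN n⟩⟩
  have hp (n : ℕ) : IsProbabilityMeasure (mixture (P n) fun k ω => Y n ω k) :=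
    isProbabilityMeasure_mixture fun k => (measurable_pi_apply k).comp (hY n)
  have hcont := continuousAt_of_tendsto_charFun (μ := fun n => mixture (P n) fun k ω => Y n ω k)
    (f := fun ξ => (c ξ : ℂ) + s ξ * Complex.I)
    (fun φ hφ ⟨C, hC⟩ => by
      obtain ⟨a, ha⟩ := hinit φ hφ ⟨C, hC⟩
      simp only [integral_empiricalMeasure] at ha
      refine ⟨a, ((tendsto_moments (fun n => (continuous_avg hφ.continuous).measurable.comp (hY n))
        (fun n ω => abs_avg_le hC _) ha).1).congr fun n => ?_⟩
      exact (integral_mixture_avg (hY n) hφ.continuous hC).symm)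
    (fun ξ => by
      refine (ofReal_add_mul_I_tendsto (hcos ξ) (hsin ξ)).congr fun n => ?_
      rw [charFun_eq_cos_sin, integral_mixture_avg (hY n) (by fun_prop)
        (fun y => Real.abs_cos_le_one (ξ * y)), integral_mixture_avg (hY n) (by fun_prop)
        (fun y => Real.abs_sin_le_one (ξ * y))])
  have hc0 : c 0 = 1 := by
    refine tendsto_nhds_unique (hcos 0) (tendsto_const_nhds.congr fun n => ?_)
    have : (N n : ℝ) ≠ 0 := by exact_mod_cast (hN n).ne'
    simp [avg, this]
  have hs0 : s 0 = 0 := by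
    refine tendsto_nhds_unique (hsin 0) (tendsto_const_nhds.congr fun n => ?_)
    simp [avg]
  have hre := (Complex.continuous_re.tendsto _).comp hcont
  have him := (Complex.continuous_im.tendsto _).comp hcont
  simp only [Function.comp_def, Complex.add_re, Complex.ofReal_re, Complex.re_ofReal_mul,
    Complex.I_re, mul_zero, add_zero, Complex.add_im, Complex.ofReal_im, Complex.im_ofReal_mul,
    Complex.I_im, mul_one, zero_add, hc0, hs0] at hre him
  exact ⟨hre, him⟩

theorem exists_limit_of_pos (hα₁₂ : 0 ≤ α₁₂) (hα₂₁ : 0 ≤ α₂₁)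
    (hN₁ : Tendsto N₁ atTop atTop) (hN₂ : Tendsto N₂ atTop atTop)
    (hN₁' : ∀ n, 0 < N₁ n) (hN₂' : ∀ n, 0 < N₂ n)
    (hX : ∀ n, IsParticleSystem v₁ v₂ α₁₂ α₂₁ (P n) (𝓕 n) (X n))
    (hinit₁ : ∀ φ : ℝ → ℝ, ContDiff ℝ 1 φ → (∃ C : ℝ, ∀ x, |φ x| ≤ C) →
      ∃ a : ℝ, TendstoInProbability P
        (fun n ω => ∫ x, φ x ∂(empiricalMeasure (X n 0 ω).1)) a)
    (hinit₂ : ∀ φ : ℝ → ℝ, ContDiff ℝ 1 φ → (∃ C : ℝ, ∀ x, |φ x| ≤ C) →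
      ∃ a : ℝ, TendstoInProbability P
        (fun n ω => ∫ x, φ x ∂(empiricalMeasure (X n 0 ω).2)) a) :
    ∃ m₁ m₂ : ℝ≥0 → ProbabilityMeasure ℝ,
      (∀ t : ℝ≥0,
        TendstoWeaklyInProbability P (fun n ω => empiricalMeasure (X n t ω).1) (m₁ t) ∧
        TendstoWeaklyInProbability P (fun n ω => empiricalMeasure (X n t ω).2) (m₂ t)) ∧
      IsWeakSolution v₁ v₂ α₁₂ α₂₁ m₁ m₂ := by
  have hm₁ (n : ℕ) (t : ℝ≥0) : Measurable fun ω => (X n t ω).1 :=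
    measurable_fst.comp ((hX n).measurable t)
  have hm₂ (n : ℕ) (t : ℝ≥0) : Measurable fun ω => (X n t ω).2 :=
    measurable_snd.comp ((hX n).measurable t)
  have hmom₁ (φ : ℝ → ℝ) (hφ : IsBddC1 φ) : ∃ a,
      Tendsto (fun n => ∫ ω, avg φ (X n 0 ω).1 ∂(P n)) atTop (𝓝 a) ∧
      Tendsto (fun n => ∫ ω, avg φ (X n 0 ω).1 * avg φ (X n 0 ω).1 ∂(P n)
        - (∫ ω, avg φ (X n 0 ω).1 ∂(P n)) * ∫ ω, avg φ (X n 0 ω).1 ∂(P n)) atTop (𝓝 0) := by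
    obtain ⟨C, hC⟩ := hφ.bdd
    obtain ⟨a, ha⟩ := hinit₁ φ hφ.contDiff hφ.bdd
    simp only [integral_empiricalMeasure] at ha
    exact ⟨a, tendsto_moments (fun n => (continuous_avg hφ.contDiff.continuous).measurable.comp
      (hm₁ n 0)) (fun n ω => abs_avg_le hC _) ha⟩
  have hmom₂ (φ : ℝ → ℝ) (hφ : IsBddC1 φ) : ∃ a,
      Tendsto (fun n => ∫ ω, avg φ (X n 0 ω).2 ∂(P n)) atTop (𝓝 a) ∧
      Tendsto (fun n => ∫ ω, avg φ (X n 0 ω).2 * avg φ (X n 0 ω).2 ∂(P n)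
        - (∫ ω, avg φ (X n 0 ω).2 ∂(P n)) * ∫ ω, avg φ (X n 0 ω).2 ∂(P n)) atTop (𝓝 0) := by
    obtain ⟨C, hC⟩ := hφ.bdd
    obtain ⟨a, ha⟩ := hinit₂ φ hφ.contDiff hφ.bdd
    simp only [integral_empiricalMeasure] at ha
    exact ⟨a, tendsto_moments (fun n => (continuous_avg hφ.contDiff.continuous).measurable.comp
      (hm₂ n 0)) (fun n ω => abs_avg_le hC _) ha⟩
  have hmom (ξ : ℝ) : ∀ k : Fin 4, ∃ a,
      Tendsto (fun n => trigMean (P n) (X n) ξ k 0) atTop (𝓝 a) ∧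
      Tendsto (fun n => trigVar (P n) (X n) ξ k 0) atTop (𝓝 0) := by
    unfold trigVar trigMean
    rw [Real.toNNReal_zero]
    refine forall_fin_four ?_ ?_ ?_ ?_
    · have h := hmom₁ _ (isBddC1_cos ξ)
      exact h
    · have h := hmom₁ _ (isBddC1_sin ξ)
      exact h
    · have h := hmom₂ _ (isBddC1_cos ξ)
      exact h
    · have h := hmom₂ _ (isBddC1_sin ξ)
      exact h
  have hlim (t : ℝ≥0) (ξ : ℝ) (k : Fin 4) :
      ∃ a, Tendsto (fun n => trigMean (P n) (X n) ξ k t) atTop (𝓝 a) :=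
    exists_tendsto_trigMean hN₁' hN₂' hX (fun k => (hmom ξ k).imp fun _ h => h.1) t.2 k
  choose z hz using hlim
  have hvar (t : ℝ≥0) (ξ : ℝ) (k : Fin 4) :
      Tendsto (fun n => trigVar (P n) (X n) ξ k t) atTop (𝓝 0) :=
    tendsto_trigVar hN₁ hN₂ hN₁' hN₂' hα₁₂ hα₂₁ hX (fun k => (hmom ξ k).choose_spec.2) t.2 k
  -- The Baire argument enters only here, at time `0`.
  have hzc0 : ∀ k : Fin 4, Tendsto (fun ξ => z 0 ξ k) (𝓝 0) (𝓝 (![1, 0, 1, 0] k)) := by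
    have hz' (ξ : ℝ) (k : Fin 4) : Tendsto (fun n => ∫ ω, trigObs ξ k (X n 0 ω) ∂(P n)) atTop
        (𝓝 (z 0 ξ k)) := by
      simpa [trigMean] using hz 0 ξ k
    have k₁ := tendsto_trig_zero hN₁' (fun n => hm₁ n 0) hinit₁ (fun ξ => hz' ξ 0)
      (fun ξ => hz' ξ 1)
    have k₂ := tendsto_trig_zero hN₂' (fun n => hm₂ n 0) hinit₂ (fun ξ => hz' ξ 2)
      (fun ξ => hz' ξ 3)
    exact forall_fin_four k₁.1 k₁.2 k₂.1 k₂.2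
  have hzc (t : ℝ≥0) : ∀ k, Tendsto (fun ξ => z t ξ k) (𝓝 0) (𝓝 (![1, 0, 1, 0] k)) :=
    tendsto_limit_trigMean_zero hN₁' hN₂' hX t.2 (fun ξ k => hz 0 ξ k) (fun ξ k => hz t ξ k) hzc0
  have hz' (t : ℝ≥0) (ξ : ℝ) (k : Fin 4) :
      Tendsto (fun n => ∫ ω, trigObs ξ k (X n t ω) ∂(P n)) atTop (𝓝 (z t ξ k)) := by
    simpa [trigMean] using hz t ξ k
  have hv' (t : ℝ≥0) (ξ : ℝ) (k : Fin 4) :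
      Tendsto (fun n => ∫ ω, trigObs ξ k (X n t ω) * trigObs ξ k (X n t ω) ∂(P n)
        - (∫ ω, trigObs ξ k (X n t ω) ∂(P n)) * ∫ ω, trigObs ξ k (X n t ω) ∂(P n)) atTop
        (𝓝 0) := by
    simpa [trigVar, trigMean] using hvar t ξ k
  have hex₁ (t : ℝ≥0) := exists_probabilityMeasure_of_trig hN₁' (fun n => hm₁ n t)
    (fun ξ => hz' t ξ 0) (fun ξ => hz' t ξ 1) (hzc t 0) (hzc t 1)
  have hex₂ (t : ℝ≥0) := exists_probabilityMeasure_of_trig hN₂' (fun n => hm₂ n t)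
    (fun ξ => hz' t ξ 2) (fun ξ => hz' t ξ 3) (hzc t 2) (hzc t 3)
  choose m₁ hchar₁ using hex₁
  choose m₂ hchar₂ using hex₂
  have w₁ (t : ℝ≥0) :
      TendstoWeaklyInProbability P (fun n ω => empiricalMeasure (X n t ω).1) (m₁ t) :=
    tendstoWeaklyInProbability_of_trig hN₁' (fun n => hm₁ n t) (m₁ t)
      (fun ξ => (hchar₁ t ξ).1 ▸ hz' t ξ 0) (fun ξ => (hchar₁ t ξ).2 ▸ hz' t ξ 1)
      (fun ξ => hv' t ξ 0) (fun ξ => hv' t ξ 1)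
  have w₂ (t : ℝ≥0) :
      TendstoWeaklyInProbability P (fun n ω => empiricalMeasure (X n t ω).2) (m₂ t) :=
    tendstoWeaklyInProbability_of_trig hN₂' (fun n => hm₂ n t) (m₂ t)
      (fun ξ => (hchar₂ t ξ).1 ▸ hz' t ξ 2) (fun ξ => (hchar₂ t ξ).2 ▸ hz' t ξ 3)
      (fun ξ => hv' t ξ 2) (fun ξ => hv' t ξ 3)
  exact ⟨m₁, m₂, fun t => ⟨w₁ t, w₂ t⟩, isWeakSolution_of_tendsto hN₁' hN₂' hX w₁ w₂⟩

end Limit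

/-! ### Discarding finitely many indices, and the main theorem -/

theorem tendstoInProbability_shift {Ω : ℕ → Type*} {mΩ : ∀ n, MeasurableSpace (Ω n)}
    (P : ∀ n, Measure (Ω n)) (Y : ∀ n, Ω n → ℝ) (a : ℝ) (n₀ : ℕ) :
    TendstoInProbability (fun n => P (n + n₀)) (fun n => Y (n + n₀)) a
      ↔ TendstoInProbability P Y a := by
  unfold TendstoInProbability
  refine forall₂_congr fun ε _ => ?_
  exact tendsto_add_atTop_iff_nat (f := fun n => P n {ω | ε ≤ |Y n ω - a|}) n₀

end TimeSync

theorem theoremt (v₁ v₂ α₁₂ α₂₁ c₁ c₂ : ℝ)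
    (hv₁ : 0 ≤ v₁) (hv₁₂ : v₁ < v₂) (hα₁₂ : 0 < α₁₂) (hα₂₁ : 0 < α₂₁)
    (hc₁ : 0 < c₁) (hc₂ : 0 < c₂) (hc : c₁ + c₂ = 1)
    (N₁ N₂ : ℕ → ℕ) (hN₁ : Tendsto N₁ atTop atTop) (hN₂ : Tendsto N₂ atTop atTop)
    (hNc₁ : Tendsto (fun n => (N₁ n : ℝ) / ((N₁ n : ℝ) + (N₂ n : ℝ))) atTop (𝓝 c₁))
    (hNc₂ : Tendsto (fun n => (N₂ n : ℝ) / ((N₁ n : ℝ) + (N₂ n : ℝ))) atTop (𝓝 c₂))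
    {Ω : ℕ → Type*} {mΩ : ∀ n, MeasurableSpace (Ω n)}
    (P : ∀ n, Measure (Ω n)) (hP : ∀ n, IsProbabilityMeasure (P n))
    (𝓕 : ∀ n, Filtration ℝ≥0 (mΩ n))
    (X : ∀ n, ℝ≥0 → Ω n → TimeSync.Config (N₁ n) (N₂ n))
    (hX : ∀ n, TimeSync.IsParticleSystem v₁ v₂ α₁₂ α₂₁ (P n) (𝓕 n) (X n))
    (hinit₁ : ∀ φ : ℝ → ℝ, ContDiff ℝ 1 φ → (∃ C : ℝ, ∀ x, |φ x| ≤ C) →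
      ∃ a : ℝ, TimeSync.TendstoInProbability P
        (fun n ω => ∫ x, φ x ∂(TimeSync.empiricalMeasure (X n 0 ω).1)) a)
    (hinit₂ : ∀ φ : ℝ → ℝ, ContDiff ℝ 1 φ → (∃ C : ℝ, ∀ x, |φ x| ≤ C) →
      ∃ a : ℝ, TimeSync.TendstoInProbability P
        (fun n ω => ∫ x, φ x ∂(TimeSync.empiricalMeasure (X n 0 ω).2)) a) :
    ∃ m₁ m₂ : ℝ≥0 → ProbabilityMeasure ℝ,
      (∀ t : ℝ≥0,
        TimeSync.TendstoWeaklyInProbability P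
          (fun n ω => TimeSync.empiricalMeasure (X n t ω).1) (m₁ t) ∧
        TimeSync.TendstoWeaklyInProbability P
          (fun n ω => TimeSync.empiricalMeasure (X n t ω).2) (m₂ t)) ∧
      TimeSync.IsWeakSolution v₁ v₂ α₁₂ α₂₁ m₁ m₂ := by
  -- The formulas for the generator need both particle numbers positive, which may fail for small
  -- `n`; the sequence is shifted by `n₀`, which changes no limit.
  obtain ⟨n₀, hn₀⟩ := eventually_atTop.1
    ((hN₁.eventually_gt_atTop 0).and (hN₂.eventually_gt_atTop 0))
  have shift (Y : ∀ n, Ω n → ℝ) (a : ℝ) := TimeSync.tendstoInProbability_shift P Y a n₀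
  have h₁ (φ : ℝ → ℝ) (hφ : ContDiff ℝ 1 φ) (hb : ∃ C : ℝ, ∀ x, |φ x| ≤ C) :
      ∃ a : ℝ, TimeSync.TendstoInProbability (fun n => P (n + n₀))
        (fun n ω => ∫ x, φ x ∂(TimeSync.empiricalMeasure (X (n + n₀) 0 ω).1)) a := by
    obtain ⟨a, ha⟩ := hinit₁ φ hφ hb
    have h := (shift _ a).2 ha
    exact ⟨a, h⟩
  have h₂ (φ : ℝ → ℝ) (hφ : ContDiff ℝ 1 φ) (hb : ∃ C : ℝ, ∀ x, |φ x| ≤ C) :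
      ∃ a : ℝ, TimeSync.TendstoInProbability (fun n => P (n + n₀))
        (fun n ω => ∫ x, φ x ∂(TimeSync.empiricalMeasure (X (n + n₀) 0 ω).2)) a := by
    obtain ⟨a, ha⟩ := hinit₂ φ hφ hb
    have h := (shift _ a).2 ha
    exact ⟨a, h⟩
  have hX' (n : ℕ) := hX (n + n₀)
  obtain ⟨m₁, m₂, hm, hw⟩ := TimeSync.exists_limit_of_pos hα₁₂.le hα₂₁.le
    (hN₁.comp (tendsto_add_atTop_nat n₀)) (hN₂.comp (tendsto_add_atTop_nat n₀))
    (fun n => (hn₀ _ (Nat.le_add_left _ _)).1) (fun n => (hn₀ _ (Nat.le_add_left _ _)).2)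
    hX' h₁ h₂
  refine ⟨m₁, m₂, fun t => ⟨fun φ => ?_, fun φ => ?_⟩, hw⟩
  · exact (shift (fun n ω => ∫ x, φ x ∂(TimeSync.empiricalMeasure (X n t ω).1)) _).1
      ((hm t).1 φ)
  · exact (shift (fun n ω => ∫ x, φ x ∂(TimeSync.empiricalMeasure (X n t ω).2)) _).1
      ((hm t).2 φ)
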